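/- **Theorem 1.** Let $n\ge 2$ and $r\ge 1$ be integers. For $\theta=(a,\tau)\in\mathbb C^r\times\mathbb R^r$ (amplitudes and locations of $r$ spikes) let $\Phi(\theta)\in\mathbb C^{2n+1}$ be the vector with entries $$\Phi(\theta)_k=g_k\sum_{\ell=1}^r a_\ell\, e^{-2\pi i k\tau_\ell},\qquad g_k=\sqrt{\tfrac1{n+1}\Bigl(1-\tfrac{|k|}{n+1}\Bigr)},\qquad k=-n,\dots,n .$$ Fix $\theta^\star=(a^\star,\tau^\star)$ with $a^\star_\ell\neq 0$ for all $\ell$, and consider the loss $\mathcal L(\theta)=\frac12\|\Phi(\theta)-\Phi(\theta^\star)\|_2^2$. Its gradient $\nabla\mathcal L(\theta)\in\mathbb C^r\times\mathbb R^r$ has the entries $\partial\mathcal L/\partial(\operatorname{Re}a_j)+i\,\partial\mathcal L/\partial(\operatorname{Im}a_j)$ and $\partial\mathcal L/\partial\tau_j$. Write $\|a^\star\|_\infty=\max_\ell|a^\star_\ell|$, $a^\star_{\min}=\min_\ell|a^\star_\ell|$ and $\Delta(\tau^\star)=\min_{\ell\ne\ell'}\inf_{p\in\mathbb Z}|\tau^\star_\ell-\tau^\star_{\ell'}+p|$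 (with $\Delta(\tau^\star)=+\infty$ if $r=1$). Let $N=2n+1$ and let $F_N(t)=\frac1{n+1}\sum_{k=-n}^n\bigl(1-\frac{|k|}{n+1}\bigr)e^{2\pi i k t}$ be the normalized Fejér kernel; then $F_N''(0)<0$. For a parameter $A$ define the diagonal matrices $$P=\operatorname{diag}\bigl(\mathbf 1_r,\,-F_N''(0)^{-1}A^{-2}\mathbf 1_r\bigr),\qquad S=\operatorname{diag}\bigl((1/a^\star_j)_{j\le r},\,\sqrt{-F_N''(0)}\,\mathbf 1_r\bigr),$$ so that $\|S(\theta-\theta^\star)\|_\infty=\max_j\max\bigl\{|a_j-a_j^\star|/|a_j^\star|,\ \sqrt{-F_N''(0)}\,|\tau_j-\tau_j^\star|\bigr\}$. Suppose that $A\ge\frac32\|a^\star\|_\infty$ and that $$\eta:=276.21\,\frac{A^2\|a^\star\|_\infty}{(a^\star_{\min})^3}\bigl((n+1)\Delta(\tau^\star)\bigr)^{-2}<1$$ (in particular $\Delta(\tau^\star)>0$; $\eta=0$ if $r=1$). If $\theta_0$ satisfies $\|S(\theta_0-\theta^\star)\|_\infty\le\frac12$, then the iterates $\theta_{k+1}=\theta_k-P\nabla\mathcal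 L(\theta_k)$ converge to $\theta^\star$, and for all $k\in\mathbb N$ $$\|S(\theta_k-\theta^\star)\|_\infty\le\Bigl(1-\frac14\frac{(a^\star_{\min})^2}{A^2}(1-\eta)\Bigr)^k\|S(\theta_0-\theta^\star)\|_\infty .$$ -/

import Mathlib

namespace SpikeDeconv

noncomputable section

/-- The parameters `θ = (a, τ)` of `r` spikes: complex amplitudes `a` and real locations `τ`.
The norm of this type is the entrywise sup-norm. -/
abbrev Params (r : ℕ) : Type := (Fin r → ℂ) × (Fin r → ℝ)

/-- The sampled transfer function `g_k = √((1 - |k|/(n+1)) / (n+1))`, `-n ≤ k ≤ n`. -/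
def psf (n : ℕ) (k : ℤ) : ℝ :=
  Real.sqrt (1 / ((n : ℝ) + 1) * (1 - |(k : ℝ)| / ((n : ℝ) + 1)))

/-- The Fourier transform at the frequency `f` of the discrete measure
`μ(θ) = ∑ ℓ, a_ℓ δ_{τ_ℓ}`, that is, `∫ exp(-2π i f t) dμ(θ)(t)`. -/
def fourierMeasure {r : ℕ} (θ : Params r) (f : ℝ) : ℂ :=
  ∑ l, θ.1 l * Complex.exp (-(Complex.I * 2 * Real.pi * f * θ.2 l))

/-- The `k`-th entry of the observation `Φ(μ(θ))`, `-n ≤ k ≤ n`. The locations are measured in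
units of the length of the observation window, so that the sampled frequencies are the
integers `k` and the locations matter only modulo `1`. -/
def observation (n : ℕ) {r : ℕ} (θ : Params r) (k : ℤ) : ℂ :=
  (psf n k : ℂ) * fourierMeasure θ (k : ℝ)

/-- The loss `L(θ) = ½ ‖Φ(μ(θ)) - x‖₂²` for the data `x = Φ(μ(θ⋆))`. -/
def loss (n : ℕ) {r : ℕ} (θstar θ : Params r) : ℝ :=
  1 / 2 * ∑ k ∈ Finset.Icc (-(n : ℤ)) (n : ℤ), ‖observation n θ k - observation n θstar k‖ ^ 2

/-- The gradient of the loss, entry by entry. The entry of a complex amplitude is the gradient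
with respect to the real inner product `Re (conj z * w)` of `ℂ`, i.e. `∂L/∂(Re a_j) + i ∂L/∂(Im a_j)`;
the entry of a location is the partial derivative. -/
def gradLoss (n : ℕ) {r : ℕ} (θstar θ : Params r) : Params r :=
  (fun j => gradient (fun z : ℂ => loss n θstar (Function.update θ.1 j z, θ.2)) (θ.1 j),
   fun j => deriv (fun t : ℝ => loss n θstar (θ.1, Function.update θ.2 j t)) (θ.2 j))

/-- The normalized Fejér kernel of order `2n+1`, as a real-valued function
(the sum is real, see `ofReal_fejer`). -/
def fejer (n : ℕ) (t : ℝ) : ℝ :=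
  (1 / ((n : ℂ) + 1) * ∑ k ∈ Finset.Icc (-(n : ℤ)) (n : ℤ),
    (1 - ((|k| : ℤ) : ℂ) / ((n : ℂ) + 1)) * Complex.exp (Complex.I * 2 * Real.pi * k * t)).re

/-- The curvature `F_N''(0)` of the Fejér kernel at the origin. -/
def fejerCurv (n : ℕ) : ℝ := iteratedDeriv 2 (fejer n) 0

/-- The fixed diagonal preconditioner `P = diag(1, -F_N''(0)⁻¹ A⁻²)`. -/
def precond (n : ℕ) {r : ℕ} (A : ℝ) (v : Params r) : Params r :=
  (v.1, fun j => (-(fejerCurv n)⁻¹ * (A ^ 2)⁻¹) * v.2 j)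

/-- The diagonal weighting `S = diag((a⋆)⁻¹, √(-F_N''(0)))`. -/
def weight (n : ℕ) {r : ℕ} (θstar v : Params r) : Params r :=
  (fun j => (θstar.1 j)⁻¹ * v.1 j, fun j => Real.sqrt (-(fejerCurv n)) * v.2 j)

/-- `θ` is a sequence of iterates of gradient descent on the loss, with preconditioner `P`. -/
def IsPrecondGD (n : ℕ) {r : ℕ} (A : ℝ) (θstar : Params r) (θ : ℕ → Params r) : Prop :=
  ∀ k, θ (k + 1) = θ k - precond n A (gradLoss n θstar (θ k))

/-- The smallest modulus of the amplitudes (for `0 < r`). -/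
def ampMin {r : ℕ} (a : Fin r → ℂ) : ℝ := ⨅ j, ‖a j‖

/-- The minimal wrap-around distance; it is `0` if two locations agree modulo `1`, and `∞` for
a single location. -/
def wrapDist {r : ℕ} (τ : Fin r → ℝ) : ENNReal :=
  ⨅ (l : Fin r) (l' : Fin r) (_ : l ≠ l') (p : ℤ), ENNReal.ofReal |τ l - τ l' + p|

/-- `η = 276.21 · A² ‖a⋆‖∞ / (a⋆_min)³ · ((n+1) Δ(τ⋆))⁻²`, in `[0, ∞]`. -/
def eta (n : ℕ) {r : ℕ} (A : ℝ) (θstar : Params r) : ENNReal :=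
  ENNReal.ofReal (276.21 * (A ^ 2 * ‖θstar.1‖ / ampMin θstar.1 ^ 3)) *
    ((((n : ENNReal) + 1) * wrapDist θstar.2) ^ 2)⁻¹

theorem ofReal_fejer (n : ℕ) (t : ℝ) :
    (fejer n t : ℂ) = 1 / ((n : ℂ) + 1) * ∑ k ∈ Finset.Icc (-(n : ℤ)) (n : ℤ),
      (1 - ((|k| : ℤ) : ℂ) / ((n : ℂ) + 1)) *
        Complex.exp (Complex.I * 2 * Real.pi * k * t) := by
  unfold fejer
  apply Complex.conj_eq_iff_re.mp
  rw [map_mul, map_sum]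
  congr 1
  · simp
  · refine Finset.sum_equiv (Equiv.neg ℤ) ?_ ?_
    · intro k
      simp only [Finset.mem_Icc, Equiv.neg_apply]
      omega
    · intro k _
      simp [← Complex.exp_conj, Complex.conj_ofNat]

end

end SpikeDeconv

namespace SpikeDeconv

noncomputable section

open scoped ComplexConjugate InnerProductSpace

/-! Because g_k² are the Fejér coefficients, every inner product of atoms is a value of F_N, and the
gradient is a superposition of values of F_N and F_N' (`gradLoss_fst`, `gradLoss_snd`). Write e for
the weighted error, C = -F_N''(0), b = (a⋆_min)²/A² and δ = τ_j - τ⋆_j. One step then splits, spike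
by spike, into a self term and an interference term.

Self terms: F_N(0) = 1, so a unit amplitude step removes the old amplitude error and leaves a⋆_j
(F_N(δ) - 1), of relative size at most e²/2 ≤ e/4 (`abs_fejer_sub_one_le`). The location step
replaces δ by δ + R F_N'(δ)/C with R = Re(conj(a_j) a⋆_j)/A². For (n+1)|δ| ≤ 1/4 the quotient
-F_N'(δ)/(Cδ) lies between 2/π and 1, and b/2 ≤ R ≤ 2/3, so |δ| shrinks by the factor 1 - b/4
(`abs_add_mul_fejerDeriv_le`).

Interference: the terms a_l F_N(τ_j - τ_l) - a⋆_l F_N(τ_j - τ⋆_l) vanish when spike l is exact, so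
they are at most e times values of F_N, F_N', F_N'' far from the integers, which decay like the
inverse squared distance (`fejer_far_field`, `cross_term_le`). Separated points have summable
inverse squares (`sum_inv_intDist_sq_le`), and the total is a small multiple of ηbe
(`interference_le`).

Together these give the contraction factor 1 - b(1 - η)/4 (`weight_step_le`). The ball e ≤ 1/2 is
therefore invariant, and the estimate iterates. -/

/-! ### Fejér coefficients and their moments. -/

/-- The squared transfer function `g_k² = (1 - |k|/(n+1)) / (n+1)`, `-n ≤ k ≤ n`. -/
def fejerCoeff (n : ℕ) (k : ℤ) : ℝ := 1 / ((n : ℝ) + 1) * (1 - |(k : ℝ)| / ((n : ℝ) + 1))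

/-- The first derivative of the Fejér kernel. -/
def fejerDeriv (n : ℕ) (t : ℝ) : ℝ :=
  ∑ k ∈ Finset.Icc (-(n : ℤ)) n,
    fejerCoeff n k * (-(2 * Real.pi * k) * Real.sin (2 * Real.pi * k * t))

/-- The second derivative of the Fejér kernel. -/
def fejerDerivTwo (n : ℕ) (t : ℝ) : ℝ :=
  ∑ k ∈ Finset.Icc (-(n : ℤ)) n,
    fejerCoeff n k * (-(2 * Real.pi * k) ^ 2 * Real.cos (2 * Real.pi * k * t))

theorem abs_le_of_mem_Icc {n : ℕ} {k : ℤ} (hk : k ∈ Finset.Icc (-(n : ℤ)) n) :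
    |(k : ℝ)| ≤ n := by
  rw [Finset.mem_Icc] at hk
  exact_mod_cast abs_le.2 hk

theorem fejerCoeff_nonneg {n : ℕ} {k : ℤ} (hk : k ∈ Finset.Icc (-(n : ℤ)) n) :
    0 ≤ fejerCoeff n k := by
  have h := abs_le_of_mem_Icc hk
  have hn : (0 : ℝ) < (n : ℝ) + 1 := by positivity
  have : |(k : ℝ)| / ((n : ℝ) + 1) ≤ 1 := by
    rw [div_le_one hn]; linarith
  exact mul_nonneg (by positivity) (by linarith)

theorem psf_sq {n : ℕ} {k : ℤ} (hk : k ∈ Finset.Icc (-(n : ℤ)) n) :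
    psf n k ^ 2 = fejerCoeff n k :=
  Real.sq_sqrt (fejerCoeff_nonneg hk)

theorem fejerCoeff_neg (n : ℕ) (k : ℤ) : fejerCoeff n (-k) = fejerCoeff n k := by
  simp [fejerCoeff]

theorem fejerCoeff_eq (n : ℕ) (k : ℤ) :
    fejerCoeff n k = (((n : ℝ) + 1) ^ 2)⁻¹ * ((n : ℝ) + 1 - |(k : ℝ)|) := by
  unfold fejerCoeff
  field_simp

theorem sum_Icc_neg_succ {M : Type*} [AddCommMonoid M] (f : ℤ → M) (n : ℕ) :
    ∑ k ∈ Finset.Icc (-((n + 1 : ℕ) : ℤ)) ((n + 1 : ℕ) : ℤ), f k =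
      ∑ k ∈ Finset.Icc (-(n : ℤ)) n, f k + (f (n + 1) + f (-(n + 1))) := by
  have : Finset.Icc (-((n + 1 : ℕ) : ℤ)) ((n + 1 : ℕ) : ℤ) =
      insert (-(n + 1 : ℤ)) (insert (n + 1 : ℤ) (Finset.Icc (-(n : ℤ)) n)) := by
    ext k
    simp only [Finset.mem_Icc, Finset.mem_insert]
    omega
  rw [this, Finset.sum_insert, Finset.sum_insert]
  · abel
  all_goals simp only [Finset.mem_Icc, Finset.mem_insert]; omega

theorem sum_Icc_neg_eq_zero_of_odd {M : Type*} [AddCommGroup M] [IsAddTorsionFree M]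
    {f : ℤ → M} (hf : ∀ k, f (-k) = -f k) (n : ℕ) :
    ∑ k ∈ Finset.Icc (-(n : ℤ)) n, f k = 0 := by
  induction n with
  | zero =>
    have := hf 0
    simpa [self_eq_neg] using this
  | succ n ih => rw [sum_Icc_neg_succ, ih, hf]; simp

/-- Passing from order `n` to order `n + 1` adds a Dirichlet sum to a triangular sum. -/
theorem triangular_sum_succ (f : ℤ → ℝ) (n : ℕ) :
    ∑ k ∈ Finset.Icc (-((n + 1 : ℕ) : ℤ)) ((n + 1 : ℕ) : ℤ),
        (((n + 1 : ℕ) : ℝ) + 1 - |(k : ℝ)|) * f k =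
      ∑ k ∈ Finset.Icc (-(n : ℤ)) n, ((n : ℝ) + 1 - |(k : ℝ)|) * f k +
        ∑ k ∈ Finset.Icc (-((n + 1 : ℕ) : ℤ)) ((n + 1 : ℕ) : ℤ), f k := by
  have h : |(-1 : ℝ) + -(n : ℝ)| = (n : ℝ) + 1 := by
    rw [abs_of_nonpos (by linarith [n.cast_nonneg (α := ℝ)])]; ring
  have h' : |(n : ℝ) + 1| = (n : ℝ) + 1 := abs_of_nonneg (by positivity)
  rw [sum_Icc_neg_succ, sum_Icc_neg_succ f, ← add_assoc (Finset.sum _ _),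
    ← add_assoc (Finset.sum _ fun k => (_ : ℝ) * f k), ← Finset.sum_add_distrib, add_assoc]
  congr 1
  · refine Finset.sum_congr rfl fun k _ => ?_
    push_cast; ring
  · push_cast
    rw [neg_add_rev, h, h']; ring

theorem sum_fejerCoeff_mul (n : ℕ) (f : ℤ → ℝ) :
    ∑ k ∈ Finset.Icc (-(n : ℤ)) n, fejerCoeff n k * f k = (((n : ℝ) + 1) ^ 2)⁻¹ *
      ∑ k ∈ Finset.Icc (-(n : ℤ)) n, ((n : ℝ) + 1 - |(k : ℝ)|) * f k := by
  rw [Finset.mul_sum]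
  exact Finset.sum_congr rfl fun k _ => by rw [fejerCoeff_eq, mul_assoc]

theorem sum_fejerCoeff (n : ℕ) : ∑ k ∈ Finset.Icc (-(n : ℤ)) n, fejerCoeff n k = 1 := by
  have hd (n : ℕ) : ∑ k ∈ Finset.Icc (-(n : ℤ)) n, (1 : ℝ) = 2 * n + 1 := by
    induction n with
    | zero => simp
    | succ n ih => rw [sum_Icc_neg_succ, ih]; push_cast; ring
  have ht : ∑ k ∈ Finset.Icc (-(n : ℤ)) n, ((n : ℝ) + 1 - |(k : ℝ)|) * 1 = ((n : ℝ) + 1) ^ 2 := by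
    induction n with
    | zero => simp
    | succ n ih => rw [triangular_sum_succ (fun _ => 1), ih, hd]; push_cast; ring
  have := sum_fejerCoeff_mul n fun _ => 1
  rw [ht, inv_mul_cancel₀ (by positivity)] at this
  simpa using this

theorem sum_fejerCoeff_mul_sq (n : ℕ) :
    ∑ k ∈ Finset.Icc (-(n : ℤ)) n, fejerCoeff n k * (k : ℝ) ^ 2 = n * (n + 2) / 6 := by
  have hd (n : ℕ) : ∑ k ∈ Finset.Icc (-(n : ℤ)) n, (k : ℝ) ^ 2 =
      n * (n + 1) * (2 * n + 1) / 3 := by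
    induction n with
    | zero => simp
    | succ n ih => rw [sum_Icc_neg_succ, ih]; push_cast; ring
  have ht : ∑ k ∈ Finset.Icc (-(n : ℤ)) n, ((n : ℝ) + 1 - |(k : ℝ)|) * (k : ℝ) ^ 2 =
      (n : ℝ) * (n + 1) ^ 2 * (n + 2) / 6 := by
    induction n with
    | zero => simp
    | succ n ih => rw [triangular_sum_succ (fun k => (k : ℝ) ^ 2), ih, hd]; push_cast; ring
  rw [sum_fejerCoeff_mul, ht]
  field_simp

/-! ### The Fejér kernel and its derivatives as trigonometric sums. -/

theorem ofReal_fejerCoeff (n : ℕ) (k : ℤ) :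
    (fejerCoeff n k : ℂ) = 1 / ((n : ℂ) + 1) * (1 - ((|k| : ℤ) : ℂ) / ((n : ℂ) + 1)) := by
  rw [fejerCoeff, ← Int.cast_abs, ← Complex.ofReal_intCast]
  simp only [Complex.ofReal_mul, Complex.ofReal_sub, Complex.ofReal_div, Complex.ofReal_add,
    Complex.ofReal_one, Complex.ofReal_natCast]

theorem ofReal_fejer_eq_sum (n : ℕ) (t : ℝ) :
    (fejer n t : ℂ) = ∑ k ∈ Finset.Icc (-(n : ℤ)) n,
      (fejerCoeff n k : ℂ) * Complex.exp (Complex.I * (2 * Real.pi * k * t : ℝ)) := by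
  rw [ofReal_fejer, Finset.mul_sum]
  refine Finset.sum_congr rfl fun k _ => ?_
  rw [ofReal_fejerCoeff, ← mul_assoc]
  congr 2
  push_cast; ring

theorem exp_I_mul_ofReal (x : ℝ) :
    Complex.exp (Complex.I * x) = (Real.cos x : ℂ) + (Real.sin x : ℂ) * Complex.I := by
  rw [mul_comm, Complex.exp_mul_I, Complex.ofReal_cos, Complex.ofReal_sin]

theorem fejer_eq_sum_cos (n : ℕ) (t : ℝ) :
    fejer n t = ∑ k ∈ Finset.Icc (-(n : ℤ)) n,
      fejerCoeff n k * Real.cos (2 * Real.pi * k * t) := by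
  have h := congrArg Complex.re (ofReal_fejer_eq_sum n t)
  rw [Complex.ofReal_re, Complex.re_sum] at h
  rw [h]
  refine Finset.sum_congr rfl fun k _ => ?_
  rw [exp_I_mul_ofReal, Complex.re_ofReal_mul]
  simp only [Complex.add_re, Complex.ofReal_re, Complex.mul_I_re, Complex.ofReal_im, neg_zero,
    add_zero]

/-- The imaginary part of the summand is odd in k and cancels over the symmetric range. The complex
form is the one that appears in the gradient. -/
theorem ofReal_fejerDeriv_eq_sum (n : ℕ) (t : ℝ) :
    (fejerDeriv n t : ℂ) = ∑ k ∈ Finset.Icc (-(n : ℤ)) n, (fejerCoeff n k : ℂ) *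
      (Complex.I * (2 * Real.pi * k : ℝ) * Complex.exp (Complex.I * (2 * Real.pi * k * t : ℝ))) := by
  have hodd : ∑ k ∈ Finset.Icc (-(n : ℤ)) n,
      (fejerCoeff n k * (2 * Real.pi * k * Real.cos (2 * Real.pi * k * t))) = 0 := by
    refine sum_Icc_neg_eq_zero_of_odd (fun k => ?_) n
    rw [fejerCoeff_neg]
    push_cast
    rw [show 2 * Real.pi * -(k : ℝ) * t = -(2 * Real.pi * k * t) by ring, Real.cos_neg]
    ring
  have : (fejerDeriv n t : ℂ) = (fejerDeriv n t : ℂ) + Complex.I *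
      ((∑ k ∈ Finset.Icc (-(n : ℤ)) n,
      (fejerCoeff n k * (2 * Real.pi * k * Real.cos (2 * Real.pi * k * t))) : ℝ) : ℂ) := by
    rw [hodd]; simp
  rw [this, fejerDeriv, Complex.ofReal_sum, Complex.ofReal_sum, Finset.mul_sum,
    ← Finset.sum_add_distrib]
  refine Finset.sum_congr rfl fun k _ => ?_
  rw [exp_I_mul_ofReal]
  simp only [Complex.ofReal_mul, Complex.ofReal_neg]
  linear_combination -(fejerCoeff n k : ℂ) * ((2 : ℝ) : ℂ) * Real.pi * ((k : ℝ) : ℂ) *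
    Real.sin (2 * Real.pi * k * t) * Complex.I_sq

theorem hasDerivAt_fejer (n : ℕ) (t : ℝ) : HasDerivAt (fejer n) (fejerDeriv n t) t := by
  rw [show fejer n = _ from funext (fejer_eq_sum_cos n)]
  refine HasDerivAt.fun_sum fun k _ => HasDerivAt.const_mul _ ?_
  have := ((hasDerivAt_id' t).const_mul (2 * Real.pi * k)).cos
  exact this.congr_deriv (by ring)

theorem hasDerivAt_fejerDeriv (n : ℕ) (t : ℝ) :
    HasDerivAt (fejerDeriv n) (fejerDerivTwo n t) t := by
  unfold fejerDeriv
  refine HasDerivAt.fun_sum fun k _ => HasDerivAt.const_mul _ ?_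
  have := ((hasDerivAt_id' t).const_mul (2 * Real.pi * k)).sin.const_mul (-(2 * Real.pi * k))
  exact this.congr_deriv (by ring)

theorem sum_fejerCoeff_mul_freq_sq (n : ℕ) :
    ∑ k ∈ Finset.Icc (-(n : ℤ)) n, fejerCoeff n k * (2 * Real.pi * k) ^ 2 = -fejerCurv n := by
  rw [fejerCurv, iteratedDeriv_succ, iteratedDeriv_one,
    show deriv (fejer n) = fejerDeriv n from funext fun t => (hasDerivAt_fejer n t).deriv,
    (hasDerivAt_fejerDeriv n 0).deriv, fejerDerivTwo, ← Finset.sum_neg_distrib]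
  refine Finset.sum_congr rfl fun k _ => by simp

theorem neg_fejerCurv_eq (n : ℕ) : -fejerCurv n = 2 * Real.pi ^ 2 / 3 * (n * (n + 2)) := by
  rw [← sum_fejerCoeff_mul_freq_sq]
  have : ∀ k ∈ Finset.Icc (-(n : ℤ)) n, fejerCoeff n k * (2 * Real.pi * k) ^ 2 =
      4 * Real.pi ^ 2 * (fejerCoeff n k * (k : ℝ) ^ 2) := fun k _ => by ring
  rw [Finset.sum_congr rfl this, ← Finset.mul_sum, sum_fejerCoeff_mul_sq]
  ring

/-- With π² ≥ 9 this reduces to 6n(n+2) ≥ 5(n+1)², true from n = 2 on. It converts between the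
curvature and the scale n + 1; in particular √(-F_N''(0)) ≥ 2(n+1). -/
theorem five_mul_sq_le_neg_fejerCurv {n : ℕ} (hn : 2 ≤ n) :
    5 * ((n : ℝ) + 1) ^ 2 ≤ -fejerCurv n := by
  have hn' : (2 : ℝ) ≤ n := by exact_mod_cast hn
  have hpi : 9 ≤ Real.pi ^ 2 := by nlinarith [Real.pi_gt_three]
  have : 6 * ((n : ℝ) * (n + 2)) ≤ 2 * Real.pi ^ 2 / 3 * (n * (n + 2)) :=
    mul_le_mul_of_nonneg_right (by linarith) (by positivity)
  rw [neg_fejerCurv_eq]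
  nlinarith

/-! ### The kernel near the origin. -/

theorem fejer_zero (n : ℕ) : fejer n 0 = 1 := by
  simp [fejer_eq_sum_cos, sum_fejerCoeff]

theorem fejerDeriv_zero (n : ℕ) : fejerDeriv n 0 = 0 := by
  simp [fejerDeriv]

/-- Quadratic bound for the decay of the kernel near the origin. -/
theorem abs_fejer_sub_one_le (n : ℕ) (t : ℝ) :
    |fejer n t - 1| ≤ -fejerCurv n * t ^ 2 / 2 := by
  have h : fejer n t - 1 = -∑ k ∈ Finset.Icc (-(n : ℤ)) n,
      fejerCoeff n k * (1 - Real.cos (2 * Real.pi * k * t)) := by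
    simp only [mul_sub, mul_one, Finset.sum_sub_distrib, sum_fejerCoeff, fejer_eq_sum_cos]
    ring
  rw [h, abs_neg, abs_of_nonneg (Finset.sum_nonneg fun k hk =>
    mul_nonneg (fejerCoeff_nonneg hk) (sub_nonneg.2 (Real.cos_le_one _))),
    ← sum_fejerCoeff_mul_freq_sq, Finset.sum_mul, Finset.sum_div]
  refine Finset.sum_le_sum fun k hk => ?_
  have := mul_le_mul_of_nonneg_left
    (by linarith [Real.one_sub_sq_div_two_le_cos (x := 2 * Real.pi * k * t)] :
      1 - Real.cos (2 * Real.pi * k * t) ≤ (2 * Real.pi * k * t) ^ 2 / 2) (fejerCoeff_nonneg hk)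
  linarith

theorem mul_sin_le_sq (x : ℝ) : x * Real.sin x ≤ x ^ 2 := by
  calc x * Real.sin x ≤ |x * Real.sin x| := le_abs_self _
    _ = |x| * |Real.sin x| := abs_mul _ _
    _ ≤ |x| * |x| := mul_le_mul_of_nonneg_left Real.abs_sin_le_abs (abs_nonneg x)
    _ = x ^ 2 := by rw [abs_mul_abs_self, sq]

theorem two_div_pi_mul_sq_le_mul_sin {x : ℝ} (hx : |x| ≤ Real.pi / 2) :
    2 / Real.pi * x ^ 2 ≤ x * Real.sin x := by
  have key {y : ℝ} (h0 : 0 ≤ y) (hy : y ≤ Real.pi / 2) :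
      2 / Real.pi * y ^ 2 ≤ y * Real.sin y := by
    nlinarith [mul_le_mul_of_nonneg_left (Real.mul_le_sin h0 hy) h0]
  rcases le_total 0 x with h | h
  · exact key h (by rwa [abs_of_nonneg h] at hx)
  · simpa using key (neg_nonneg.2 h) (by rwa [abs_of_nonpos h] at hx)

/-- The factor t turns each summand into x sin x with a nonnegative coefficient, so bounds on x sin
x transfer term by term. -/
theorem neg_mul_fejerDeriv_eq (n : ℕ) (t : ℝ) :
    -(t * fejerDeriv n t) = ∑ k ∈ Finset.Icc (-(n : ℤ)) n,
      fejerCoeff n k * ((2 * Real.pi * k * t) * Real.sin (2 * Real.pi * k * t)) := by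
  rw [fejerDeriv, Finset.mul_sum, ← Finset.sum_neg_distrib]
  exact Finset.sum_congr rfl fun k _ => by ring

theorem neg_mul_fejerDeriv_le (n : ℕ) (t : ℝ) :
    -(t * fejerDeriv n t) ≤ -fejerCurv n * t ^ 2 := by
  rw [neg_mul_fejerDeriv_eq, ← sum_fejerCoeff_mul_freq_sq, Finset.sum_mul]
  refine Finset.sum_le_sum fun k hk => ?_
  have := mul_le_mul_of_nonneg_left (mul_sin_le_sq (2 * Real.pi * k * t)) (fejerCoeff_nonneg hk)
  linarith

theorem le_neg_mul_fejerDeriv {n : ℕ} {t : ℝ} (ht : ((n : ℝ) + 1) * |t| ≤ 1 / 4) :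
    2 / Real.pi * (-fejerCurv n * t ^ 2) ≤ -(t * fejerDeriv n t) := by
  rw [neg_mul_fejerDeriv_eq, ← sum_fejerCoeff_mul_freq_sq, Finset.sum_mul, Finset.mul_sum]
  refine Finset.sum_le_sum fun k hk => ?_
  -- The hypothesis (n+1)|t| ≤ 1/4 keeps every phase in [-π/2, π/2], where Jordan's inequality is
  -- available.
  have hkt : |2 * Real.pi * k * t| ≤ Real.pi / 2 := by
    rw [abs_mul, abs_mul, abs_of_pos Real.two_pi_pos]
    have : |(k : ℝ)| * |t| ≤ ((n : ℝ) + 1) * |t| :=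
      mul_le_mul_of_nonneg_right (by linarith [abs_le_of_mem_Icc hk]) (abs_nonneg t)
    nlinarith [Real.pi_pos]
  have := mul_le_mul_of_nonneg_left (two_div_pi_mul_sq_le_mul_sin hkt) (fejerCoeff_nonneg hk)
  linarith

/-! ### Closed form and decay away from the integers. -/

/-- The closed form of the Fejér kernel, with denominators cleared. -/
theorem fejer_mul_one_sub_cos (n : ℕ) (t : ℝ) :
    fejer n t * (1 - Real.cos (2 * Real.pi * t)) =
      (1 - Real.cos (2 * Real.pi * (n + 1) * t)) / ((n : ℝ) + 1) ^ 2 := by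
  set x := 2 * Real.pi * t with hx
  have hc (y : ℝ) : Real.cos (y * x + x) + Real.cos (y * x - x) =
      2 * Real.cos (y * x) * Real.cos x := by
    rw [Real.cos_add, Real.cos_sub]; ring
  have hd (n : ℕ) : (∑ k ∈ Finset.Icc (-(n : ℤ)) n, Real.cos (k * x)) * (1 - Real.cos x) =
      Real.cos (n * x) - Real.cos ((n + 1) * x) := by
    induction n with
    | zero => simp
    | succ n ih =>
      rw [sum_Icc_neg_succ, add_mul, ih]
      have h1 := hc (n + 1)
      have e1 : ((n : ℝ) + 1) * x - x = n * x := by ring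
      have e2 : ((n : ℝ) + 1) * x + x = (n + 1 + 1) * x := by ring
      have e3 : (-1 + -(n : ℝ)) * x = -((n + 1) * x) := by ring
      rw [e1, e2] at h1
      push_cast
      rw [neg_add_rev, e3, Real.cos_neg]
      linear_combination h1
  have ht : (∑ k ∈ Finset.Icc (-(n : ℤ)) n, ((n : ℝ) + 1 - |(k : ℝ)|) * Real.cos (k * x)) *
      (1 - Real.cos x) = 1 - Real.cos ((n + 1) * x) := by
    induction n with
    | zero => simp
    | succ n ih =>
      rw [triangular_sum_succ (fun k => Real.cos (k * x)), add_mul, ih, hd]; push_cast; ring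
  have hF : fejer n t = (((n : ℝ) + 1) ^ 2)⁻¹ *
      ∑ k ∈ Finset.Icc (-(n : ℤ)) n, ((n : ℝ) + 1 - |(k : ℝ)|) * Real.cos (k * x) := by
    rw [← sum_fejerCoeff_mul, fejer_eq_sum_cos]
    refine Finset.sum_congr rfl fun k _ => ?_
    rw [hx]; congr 2; ring
  rw [hF, mul_assoc, ht, hx, div_eq_inv_mul]
  rw [show (n + 1) * (2 * Real.pi * t) = 2 * Real.pi * (n + 1) * t by ring]

/-- Both sides of `fejer_mul_one_sub_cos` are differentiated; keeping the denominator cleared avoids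
excluding integer t. -/
theorem fejerDeriv_mul_one_sub_cos (n : ℕ) (t : ℝ) :
    fejerDeriv n t * (1 - Real.cos (2 * Real.pi * t)) +
      fejer n t * (2 * Real.pi * Real.sin (2 * Real.pi * t)) =
      2 * Real.pi * Real.sin (2 * Real.pi * (n + 1) * t) / ((n : ℝ) + 1) := by
  have h1 : HasDerivAt (fun t => fejer n t * (1 - Real.cos (2 * Real.pi * t))) _ t :=
    (hasDerivAt_fejer n t).mul (((hasDerivAt_id t).const_mul (2 * Real.pi)).cos.const_sub 1)
  rw [show (fun t => fejer n t * (1 - Real.cos (2 * Real.pi * t))) = _ from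
    funext (fejer_mul_one_sub_cos n)] at h1
  have h2 := h1.unique ((((hasDerivAt_id t).const_mul
    (2 * Real.pi * ((n : ℝ) + 1))).cos.const_sub 1).div_const (((n : ℝ) + 1) ^ 2))
  simp only [id, mul_one] at h2
  rw [show fejer n t * (2 * Real.pi * Real.sin (2 * Real.pi * t)) =
    fejer n t * -(-Real.sin (2 * Real.pi * t) * (2 * Real.pi)) by ring, h2]
  field_simp

theorem fejerDerivTwo_mul_one_sub_cos (n : ℕ) (t : ℝ) :
    fejerDerivTwo n t * (1 - Real.cos (2 * Real.pi * t)) +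
      2 * fejerDeriv n t * (2 * Real.pi * Real.sin (2 * Real.pi * t)) +
      fejer n t * ((2 * Real.pi) ^ 2 * Real.cos (2 * Real.pi * t)) =
      (2 * Real.pi) ^ 2 * Real.cos (2 * Real.pi * (n + 1) * t) := by
  have h1 := ((hasDerivAt_fejerDeriv n t).fun_mul
    (((hasDerivAt_id' t).const_mul (2 * Real.pi)).cos.const_sub 1)).fun_add
    ((hasDerivAt_fejer n t).fun_mul
      (((hasDerivAt_id' t).const_mul (2 * Real.pi)).sin.const_mul (2 * Real.pi)))
  rw [funext (fejerDeriv_mul_one_sub_cos n)] at h1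
  have h2 := h1.unique ((((hasDerivAt_id' t).const_mul
    (2 * Real.pi * ((n : ℝ) + 1))).sin.const_mul (2 * Real.pi)).div_const ((n : ℝ) + 1))
  have hn : ((n : ℝ) + 1) ≠ 0 := by positivity
  simp only [mul_one] at h2
  rw [show 2 * Real.pi * (Real.cos (2 * Real.pi * ((n : ℝ) + 1) * t) *
    (2 * Real.pi * ((n : ℝ) + 1))) / ((n : ℝ) + 1) =
      (2 * Real.pi) ^ 2 * Real.cos (2 * Real.pi * (n + 1) * t) by field_simp] at h2
  rw [← h2]
  ring

/-- For y the signed distance to the nearest integer, 1 - cos 2πt = 2 sin²(πy), and Jordan's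
inequality gives sin(π|y|) ≥ 2|y|. -/
theorem eight_mul_sq_le_one_sub_cos {t ρ : ℝ} (hρ : 0 ≤ ρ) (h : ∀ p : ℤ, ρ ≤ |t + p|) :
    8 * ρ ^ 2 ≤ 1 - Real.cos (2 * Real.pi * t) := by
  set y := t - round t with hy
  have hy1 : ρ ≤ |y| := by simpa [hy, sub_eq_add_neg] using h (-round t)
  have hy2 : |y| ≤ 1 / 2 := abs_sub_round t
  have hcos : Real.cos (2 * Real.pi * t) = Real.cos (2 * (Real.pi * |y|)) := by
    rw [← Real.cos_sub_int_mul_two_pi _ (round t), ← Real.cos_abs,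
      show 2 * Real.pi * t - round t * (2 * Real.pi) = 2 * Real.pi * y by rw [hy]; ring,
      abs_mul, abs_of_pos Real.two_pi_pos, mul_assoc]
  have hs : 2 * |y| ≤ Real.sin (Real.pi * |y|) := by
    have := Real.mul_le_sin (x := Real.pi * |y|) (by positivity) (by nlinarith [Real.pi_pos])
    rwa [← mul_assoc, div_mul_cancel₀ _ Real.pi_ne_zero] at this
  rw [hcos, Real.cos_two_mul, Real.cos_sq']
  nlinarith [abs_nonneg y]

/-- Division by `q = 1 - cos 2πt` in the closed form of the Fejér kernel and in its derivatives. -/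
theorem far_field_bounds {F G H q s c m ρ w u v : ℝ} (hm : 0 < m) (hmρ : 24 ≤ m * ρ) (hρ : 0 < ρ)
    (hw : 0 < w) (hw' : w ≤ 6.3) (hu : |u| ≤ 1) (hv : |v| ≤ 1) (hc : |c| ≤ 1)
    (hq : 8 * ρ ^ 2 ≤ q) (hs : 2 * ρ * |s| ≤ q)
    (e0 : F * q = (1 - u) / m ^ 2) (e1 : G * q + F * (w * s) = w * v / m)
    (e2 : H * q + 2 * G * (w * s) + F * (w ^ 2 * c) = w ^ 2 * u) :
    |F| * (m * ρ) ^ 2 ≤ 1 / 4 ∧ |G| * (m * ρ ^ 2) ≤ 5 / 6 ∧ |H| * ρ ^ 2 ≤ 21 / 4 := by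
  -- In the application m = n + 1, w = 2π, q = 1 - cos 2πt, s and c are the sine and cosine of 2πt,
  -- and v and u those of 2π(n+1)t.
  have hq0 : 0 < q := lt_of_lt_of_le (by positivity) hq
  have hu' := abs_le.1 hu
  have b0 : |F| * q * m ^ 2 ≤ 2 := by
    have : |F| * q * m ^ 2 = |1 - u| := by
      rw [← abs_of_pos hq0, ← abs_mul, e0, abs_div, abs_of_pos (pow_pos hm 2),
        div_mul_cancel₀ _ (by positivity)]
    rw [this, abs_le]
    constructor <;> linarith [hu'.1, hu'.2]
  have d0 : |F| * (m * ρ) ^ 2 ≤ 1 / 4 := by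
    have := mul_le_mul_of_nonneg_left hq (mul_nonneg (abs_nonneg F) (sq_nonneg m))
    nlinarith only [this, b0]
  -- Since 2ρ|s| ≤ q, trading q for s gains a factor 1/(mρ) ≤ 1/24 up to constants. This makes the
  -- lower-order terms in `e1` and `e2` small corrections.
  have c0 : |F| * |s| * m ≤ 1 / 24 := by
    have h1 := mul_le_mul_of_nonneg_left hs (mul_nonneg (abs_nonneg F) (sq_nonneg m))
    have h2 := mul_le_mul_of_nonneg_left hmρ
      (mul_nonneg (mul_nonneg (abs_nonneg F) (abs_nonneg s)) hm.le)
    nlinarith only [h1, h2, b0]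
  have b1 : |G| * q * m ≤ w * (25 / 24) := by
    have h1 : G * q * m = w * v - F * s * m * w := by
      field_simp at e1
      linear_combination e1
    calc |G| * q * m = |w * v - F * s * m * w| := by
          rw [← h1, abs_mul, abs_mul, abs_of_pos hq0, abs_of_pos hm]
      _ ≤ |w * v| + |F * s * m * w| := abs_sub _ _
      _ = w * |v| + |F| * |s| * m * w := by
          simp only [abs_mul, abs_of_pos hw, abs_of_pos hm]
      _ ≤ w * 1 + 1 / 24 * w := by gcongr
      _ = w * (25 / 24) := by ring
  have c1 : |G| * |s| ≤ w * (25 / 24) / 48 := by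
    have h1 := mul_le_mul_of_nonneg_left hs (mul_nonneg (abs_nonneg G) hm.le)
    have h2 := mul_le_mul_of_nonneg_left hmρ (mul_nonneg (abs_nonneg G) (abs_nonneg s))
    nlinarith only [h1, h2, b1]
  have hF : |F| ≤ 1 / 4 / 24 ^ 2 := by
    have := mul_le_mul_of_nonneg_left (pow_le_pow_left₀ (by norm_num) hmρ 2) (abs_nonneg F)
    rw [le_div_iff₀ (by norm_num)]
    exact this.trans d0
  have hFc : |F| * |c| ≤ 1 / 4 / 24 ^ 2 * 1 := by gcongr
  have b2 : |H| * q ≤ w ^ 2 * (21 / 20) := by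
    have h1 : H * q = w ^ 2 * u - 2 * w * (G * s) - w ^ 2 * (F * c) := by linear_combination e2
    calc |H| * q = |w ^ 2 * u - 2 * w * (G * s) - w ^ 2 * (F * c)| := by
          rw [← h1, abs_mul, abs_of_pos hq0]
      _ ≤ |w ^ 2 * u| + |2 * w * (G * s)| + |w ^ 2 * (F * c)| :=
        (abs_sub _ _).trans (add_le_add_left (abs_sub _ _) _)
      _ = w ^ 2 * |u| + 2 * w * (|G| * |s|) + w ^ 2 * (|F| * |c|) := by
          simp only [abs_mul, abs_of_pos hw, abs_of_pos (pow_pos hw 2), abs_two]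
      _ ≤ w ^ 2 * 1 + 2 * w * (w * (25 / 24) / 48) + w ^ 2 * (1 / 4 / 24 ^ 2 * 1) := by gcongr
      _ ≤ w ^ 2 * (21 / 20) := by nlinarith only [sq_nonneg w]
  refine ⟨d0, ?_, ?_⟩
  · have := mul_le_mul_of_nonneg_left hq (mul_nonneg (abs_nonneg G) hm.le)
    nlinarith only [this, b1, hw']
  · have h1 := mul_le_mul_of_nonneg_left hq (abs_nonneg H)
    have h2 : w ^ 2 ≤ 6.3 ^ 2 := pow_le_pow_left₀ hw.le hw' 2
    norm_num at h2
    linarith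

/-- Bounds for the Fejér kernel and its derivatives at distance at least `ρ` from the integers. -/
theorem fejer_far_field {n : ℕ} (hn : 2 ≤ n) {t ρ : ℝ} (hρ : 24 ≤ ((n : ℝ) + 1) * ρ)
    (h : ∀ p : ℤ, ρ ≤ |t + p|) :
    |fejer n t| ≤ 1 / 2 * ((((n : ℝ) + 1) * ρ) ^ 2)⁻¹ ∧
    |fejerDeriv n t| ≤ 1 / 2 * ((((n : ℝ) + 1) * ρ) ^ 2)⁻¹ * Real.sqrt (-fejerCurv n) ∧
    |fejerDerivTwo n t| ≤ 3 / 2 * ((((n : ℝ) + 1) * ρ) ^ 2)⁻¹ * -fejerCurv n := by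
  have hC := five_mul_sq_le_neg_fejerCurv hn
  have hm0 : 0 < (n : ℝ) + 1 := by positivity
  have hρ0 : 0 < ρ := pos_of_mul_pos_right (by linarith) hm0.le
  have hq := eight_mul_sq_le_one_sub_cos hρ0.le h
  -- With q = 1 - cos 2πt one has sin² 2πt = q(2 - q) ≤ 2q, and 8ρ² ≤ q.
  have hs : 2 * ρ * |Real.sin (2 * Real.pi * t)| ≤ 1 - Real.cos (2 * Real.pi * t) := by
    have h1 := Real.sin_sq_add_cos_sq (2 * Real.pi * t)
    have h2 := Real.cos_le_one (2 * Real.pi * t)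
    refine (abs_le_of_sq_le_sq' ?_ (by linarith)).2
    rw [mul_pow, sq_abs]
    nlinarith [sq_nonneg ρ, sq_nonneg (1 - Real.cos (2 * Real.pi * t)),
      mul_le_mul_of_nonneg_left hq (sub_nonneg.2 h2)]
  obtain ⟨h0, h1, h2⟩ := far_field_bounds hm0 hρ hρ0 Real.two_pi_pos
    (by linarith [Real.pi_lt_d2]) (Real.abs_cos_le_one _) (Real.abs_sin_le_one _)
    (Real.abs_cos_le_one _) hq hs (fejer_mul_one_sub_cos n t) (fejerDeriv_mul_one_sub_cos n t)
    (fejerDerivTwo_mul_one_sub_cos n t)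
  set m : ℝ := (n : ℝ) + 1
  have hsqrt : 2 * m ≤ Real.sqrt (-fejerCurv n) :=
    Real.le_sqrt_of_sq_le (by nlinarith only [sq_nonneg m, hC])
  have hX : 0 < (m * ρ) ^ 2 := by positivity
  refine ⟨?_, ?_, ?_⟩
  · rw [← div_eq_mul_inv, le_div_iff₀ hX]
    linarith
  · rw [mul_right_comm, ← div_eq_mul_inv, le_div_iff₀ hX]
    have := mul_le_mul_of_nonneg_right h1 hm0.le
    nlinarith only [this, hsqrt, hm0]
  · rw [mul_right_comm, ← div_eq_mul_inv, le_div_iff₀ hX]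
    have := mul_le_mul_of_nonneg_right h2 (sq_nonneg m)
    nlinarith only [this, hC, sq_nonneg m]

/-! ### The gradient in terms of the Fejér kernel. -/

/-- The phase `exp(-2π i k t)`. -/
def phase (k : ℤ) (t : ℝ) : ℂ := Complex.exp (-(Complex.I * 2 * Real.pi * (k : ℝ) * t))

theorem fourierMeasure_eq {r : ℕ} (θ : Params r) (k : ℤ) :
    fourierMeasure θ (k : ℝ) = ∑ l, θ.1 l * phase k (θ.2 l) := by
  simp only [fourierMeasure, phase, Complex.ofReal_intCast]

theorem conj_phase_mul_phase (k : ℤ) (s t : ℝ) :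
    conj (phase k s) * phase k t =
      Complex.exp (Complex.I * (2 * Real.pi * k * (s - t) : ℝ)) := by
  rw [phase, phase, ← Complex.exp_conj, ← Complex.exp_add]
  congr 1
  simp only [map_neg, map_mul, Complex.conj_I, Complex.conj_ofReal, Complex.conj_ofNat]
  push_cast
  ring

theorem hasDerivAt_phase (k : ℤ) (t : ℝ) :
    HasDerivAt (phase k) (-(Complex.I * (2 * Real.pi * k : ℝ)) * phase k t) t := by
  have h := ((Complex.ofRealCLM.hasDerivAt (x := t)).const_mul
    (-(Complex.I * 2 * Real.pi * (k : ℝ)))).cexp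
  have e : phase k = fun t : ℝ => Complex.exp (-(Complex.I * 2 * Real.pi * (k : ℝ)) * t) := by
    funext t; rw [phase]; congr 1; ring
  rw [e]
  refine h.congr_deriv ?_
  simp only [Complex.ofRealCLM_apply]
  push_cast
  ring

theorem fourierMeasure_update_amp {r : ℕ} (θ : Params r) (j : Fin r) (z : ℂ) (k : ℤ) :
    fourierMeasure (Function.update θ.1 j z, θ.2) (k : ℝ) =
      fourierMeasure θ (k : ℝ) + (z - θ.1 j) * phase k (θ.2 j) := by
  rw [fourierMeasure_eq, fourierMeasure_eq, ← sub_eq_iff_eq_add', ← Finset.sum_sub_distrib,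
    Finset.sum_eq_single j]
  · simp [sub_mul]
  · intro l _ hl
    simp [hl]
  · simp

theorem fourierMeasure_update_loc {r : ℕ} (θ : Params r) (j : Fin r) (t : ℝ) (k : ℤ) :
    fourierMeasure (θ.1, Function.update θ.2 j t) (k : ℝ) =
      fourierMeasure θ (k : ℝ) + θ.1 j * (phase k t - phase k (θ.2 j)) := by
  rw [fourierMeasure_eq, fourierMeasure_eq, ← sub_eq_iff_eq_add', ← Finset.sum_sub_distrib,
    Finset.sum_eq_single j]
  · simp [mul_sub]
  · intro l _ hl
    simp [hl]
  · simp

/-- Correlating with an atom squares the transfer function, and g_k² are the coefficients of the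
Fejér kernel. -/
theorem sum_psf_mul_conj_phase_mul_observation (n : ℕ) {r : ℕ} (θ : Params r) (t : ℝ) :
    ∑ k ∈ Finset.Icc (-(n : ℤ)) n, (psf n k : ℂ) * conj (phase k t) * observation n θ k =
      ∑ l, θ.1 l * (fejer n (t - θ.2 l) : ℂ) := by
  simp only [ofReal_fejer_eq_sum, Finset.mul_sum, observation, fourierMeasure_eq]
  rw [Finset.sum_comm]
  refine Finset.sum_congr rfl fun l _ => Finset.sum_congr rfl fun k hk => ?_
  rw [← conj_phase_mul_phase, ← psf_sq hk]
  push_cast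
  ring

theorem sum_psf_mul_conj_phase_deriv_mul_observation (n : ℕ) {r : ℕ} (θ : Params r) (t : ℝ) :
    ∑ k ∈ Finset.Icc (-(n : ℤ)) n, (psf n k : ℂ) *
        (Complex.I * (2 * Real.pi * k : ℝ) * conj (phase k t)) * observation n θ k =
      ∑ l, θ.1 l * (fejerDeriv n (t - θ.2 l) : ℂ) := by
  simp only [ofReal_fejerDeriv_eq_sum, Finset.mul_sum, observation, fourierMeasure_eq]
  rw [Finset.sum_comm]
  refine Finset.sum_congr rfl fun l _ => Finset.sum_congr rfl fun k hk => ?_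
  rw [← conj_phase_mul_phase, ← psf_sq hk]
  push_cast
  ring

/-- As a function of a single amplitude, each summand of the loss has this form. -/
theorem hasFDerivAt_norm_sq_affine (c d z : ℂ) :
    HasFDerivAt (fun z : ℂ => ‖c * z + d‖ ^ 2)
      (InnerProductSpace.toDual ℝ ℂ (2 * (conj c * (c * z + d)))) z := by
  have h := ((((hasDerivAt_id' z).const_mul c).add_const d).hasFDerivAt.restrictScalars ℝ).norm_sq
  refine h.congr_fderiv ?_
  ext x
  simp [Complex.inner]
  ring

theorem gradLoss_fst (n : ℕ) {r : ℕ} (θstar θ : Params r) (j : Fin r) :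
    (gradLoss n θstar θ).1 j = ∑ l, (θ.1 l * (fejer n (θ.2 j - θ.2 l) : ℂ) -
      θstar.1 l * (fejer n (θ.2 j - θstar.2 l) : ℂ)) := by
  rw [Finset.sum_sub_distrib, ← sum_psf_mul_conj_phase_mul_observation,
    ← sum_psf_mul_conj_phase_mul_observation, ← Finset.sum_sub_distrib]
  refine HasGradientAt.gradient ?_
  rw [hasGradientAt_iff_hasFDerivAt]
  have e : (fun z : ℂ => loss n θstar (Function.update θ.1 j z, θ.2)) = fun z =>
      1 / 2 * ∑ k ∈ Finset.Icc (-(n : ℤ)) n, ‖(psf n k * phase k (θ.2 j)) * z +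
        (observation n θ k - psf n k * phase k (θ.2 j) * θ.1 j - observation n θstar k)‖ ^ 2 := by
    funext z
    unfold loss
    congr 1
    refine Finset.sum_congr rfl fun k _ => ?_
    simp only [observation, fourierMeasure_update_amp]
    congr 2
    ring
  rw [e]
  refine ((HasFDerivAt.fun_sum fun k _ =>
    hasFDerivAt_norm_sq_affine _ _ (θ.1 j)).const_mul (1 / 2)).congr_fderiv ?_
  rw [Finset.smul_sum, map_sum]
  refine Finset.sum_congr rfl fun k _ => ?_
  rw [show (psf n k * phase k (θ.2 j)) * θ.1 j + (observation n θ k -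
    psf n k * phase k (θ.2 j) * θ.1 j - observation n θstar k) =
      observation n θ k - observation n θstar k by ring]
  ext x
  simp only [one_div, map_mul, Complex.conj_ofReal, smul_apply,
    InnerProductSpace.toDual_apply_apply, smul_eq_mul, ← mul_sub]
  rw [show ∀ v : ℂ, 2 * v = (2 : ℝ) • v from fun v => by simp, real_inner_smul_left, ← mul_assoc,
    inv_mul_cancel₀ two_ne_zero, one_mul]

theorem gradLoss_snd (n : ℕ) {r : ℕ} (θstar θ : Params r) (j : Fin r) :
    (gradLoss n θstar θ).2 j = (conj (θ.1 j) *
      ∑ l, (θ.1 l * (fejerDeriv n (θ.2 j - θ.2 l) : ℂ) -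
        θstar.1 l * (fejerDeriv n (θ.2 j - θstar.2 l) : ℂ))).re := by
  rw [Finset.sum_sub_distrib, ← sum_psf_mul_conj_phase_deriv_mul_observation,
    ← sum_psf_mul_conj_phase_deriv_mul_observation, ← Finset.sum_sub_distrib, Finset.mul_sum,
    Complex.re_sum]
  refine HasDerivAt.deriv ?_
  have hk (k : ℤ) : HasDerivAt (fun t : ℝ => observation n (θ.1, Function.update θ.2 j t) k -
      observation n θstar k)
      (psf n k * (θ.1 j * (-(Complex.I * (2 * Real.pi * k : ℝ)) * phase k (θ.2 j)))) (θ.2 j) := by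
    simp only [observation, fourierMeasure_update_loc]
    exact ((((((hasDerivAt_phase k (θ.2 j)).sub_const _).const_mul _).const_add _).const_mul
      _).sub_const _)
  unfold loss
  refine ((HasDerivAt.fun_sum fun k _ => (hk k).norm_sq).const_mul (1 / 2)).congr_deriv ?_
  rw [Finset.mul_sum]
  refine Finset.sum_congr rfl fun k _ => ?_
  rw [Function.update_eq_self, ← mul_assoc, one_div, inv_mul_cancel₀ two_ne_zero, one_mul,
    ← real_inner_comm, Complex.inner]
  simp only [map_mul, map_neg, Complex.conj_ofReal, Complex.conj_I]
  congr 1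
  ring

/-! ### Separated locations and the inverse square law. -/

/-- The subtracted tail makes the induction close, by 2/(N+1) - 2/(N+2) ≥ 2/(N+2)². The term k = 0
contributes nothing because 0⁻¹ = 0. -/
theorem sum_inv_sq_Icc_le (N : ℕ) :
    ∑ k ∈ Finset.Icc (-((N + 1 : ℕ) : ℤ)) ((N + 1 : ℕ) : ℤ), ((k : ℝ) ^ 2)⁻¹ ≤
      4 - 2 / ((N : ℝ) + 1) := by
  induction N with
  | zero =>
    rw [sum_Icc_neg_succ]
    norm_num
  | succ N ih =>
    rw [sum_Icc_neg_succ]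
    refine (add_le_add_left ih _).trans ?_
    push_cast
    have e : (-((N : ℝ) + 1 + 1)) ^ 2 = ((N : ℝ) + 1 + 1) ^ 2 := by ring
    rw [e]
    have hN : (0 : ℝ) < (N : ℝ) + 1 := by positivity
    have : 2 / ((N : ℝ) + 1) - 2 / ((N : ℝ) + 1 + 1) - 2 * (((N : ℝ) + 1 + 1) ^ 2)⁻¹ =
        2 / (((N : ℝ) + 1) * ((N : ℝ) + 1 + 1) ^ 2) := by
      field_simp
      ring
    have hpos : 0 ≤ 2 / (((N : ℝ) + 1) * ((N : ℝ) + 1 + 1) ^ 2) := by positivity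
    linarith

theorem sum_inv_sq_int_le (s : Finset ℤ) : ∑ k ∈ s, ((k : ℝ) ^ 2)⁻¹ ≤ 4 := by
  obtain ⟨N, hN⟩ : ∃ N : ℕ, s ⊆ Finset.Icc (-((N + 1 : ℕ) : ℤ)) ((N + 1 : ℕ) : ℤ) := by
    refine ⟨s.sup Int.natAbs, fun k hk => ?_⟩
    have := Finset.le_sup (f := Int.natAbs) hk
    rw [Finset.mem_Icc]
    omega
  calc ∑ k ∈ s, ((k : ℝ) ^ 2)⁻¹
      ≤ ∑ k ∈ Finset.Icc (-((N + 1 : ℕ) : ℤ)) ((N + 1 : ℕ) : ℤ), ((k : ℝ) ^ 2)⁻¹ :=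
        Finset.sum_le_sum_of_subset_of_nonneg hN fun k _ _ => by positivity
    _ ≤ 4 - 2 / ((N : ℝ) + 1) := sum_inv_sq_Icc_le N
    _ ≤ 4 := sub_le_self _ (by positivity)

/-- The distance to the nearest integer. -/
def intDist (t : ℝ) : ℝ := |t - round t|

theorem intDist_le (t : ℝ) (p : ℤ) : intDist t ≤ |t + p| := by
  simpa [intDist] using round_le t (-p)

/-- Points of the circle at mutual distance at least `Δ` have a summable inverse square law. -/
theorem sum_inv_intDist_sq_le {ι : Type*} [Fintype ι] [DecidableEq ι] {τ : ι → ℝ} {Δ : ℝ}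
    (hΔ : 0 < Δ) (h : ∀ l l', l ≠ l' → ∀ p : ℤ, Δ ≤ |τ l - τ l' + p|) (j : ι) :
    ∑ l ∈ Finset.univ.erase j, (intDist (τ j - τ l) ^ 2)⁻¹ ≤ 16 * (Δ ^ 2)⁻¹ := by
  set y : ι → ℝ := fun l => (τ j - τ l - round (τ j - τ l)) / Δ with hy
  have hyd (l : ι) : intDist (τ j - τ l) = |y l| * Δ := by
    rw [hy, intDist, abs_div, abs_of_pos hΔ, div_mul_cancel₀ _ hΔ.ne']
  have hy1 (l : ι) (hl : l ≠ j) : 1 ≤ |y l| := by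
    rw [hy, abs_div, abs_of_pos hΔ, one_le_div hΔ]
    simpa [sub_eq_add_neg] using h j l hl.symm (-round (τ j - τ l))
  have hround (l : ι) (hl : l ≠ j) : 1 ≤ |(round (y l) : ℝ)| := by
    have h0 : round (y l) ≠ 0 := by
      intro h0
      have := abs_sub_round (y l)
      rw [h0, Int.cast_zero, sub_zero] at this
      linarith [hy1 l hl]
    exact_mod_cast Int.one_le_abs h0
  -- Rescaled by Δ, the points are at least 1 apart. Equal roundings would put two of them at
  -- distance less than 1, so the sum is dominated by one over distinct nonzero integers.
  have hinj : Set.InjOn (fun l => round (y l)) (Finset.univ.erase j : Finset ι) := by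
    intro l _ l' _ hll
    by_contra hne
    simp only [round_eq] at hll
    have h1 := Int.abs_sub_lt_one_of_floor_eq_floor hll
    have h2 : y l + 1 / 2 - (y l' + 1 / 2) =
        (τ l' - τ l + ((round (τ j - τ l') - round (τ j - τ l) : ℤ) : ℝ)) / Δ := by
      rw [hy]; push_cast; ring
    rw [h2, abs_div, abs_of_pos hΔ, div_lt_one hΔ] at h1
    exact absurd (h l' l (Ne.symm hne) _) (not_le.2 h1)
  calc ∑ l ∈ Finset.univ.erase j, (intDist (τ j - τ l) ^ 2)⁻¹
      ≤ ∑ l ∈ Finset.univ.erase j, 4 * (Δ ^ 2)⁻¹ * ((round (y l) : ℝ) ^ 2)⁻¹ := by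
        refine Finset.sum_le_sum fun l hl => ?_
        have hl := Finset.ne_of_mem_erase hl
        have h1 := hround l hl
        -- Rounding adds at most 1/2, which is at most |y l| since 1 ≤ |y l|.
        have h2 : |(round (y l) : ℝ)| ≤ 2 * |y l| := by
          have h3 := abs_sub_round (y l)
          have h4 := abs_sub_abs_le_abs_sub (round (y l) : ℝ) (y l)
          rw [abs_sub_comm] at h4
          linarith
        rw [hyd, show 4 * (Δ ^ 2)⁻¹ * ((round (y l) : ℝ) ^ 2)⁻¹ =
          ((|(round (y l) : ℝ)| / 2 * Δ) ^ 2)⁻¹ by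
            rw [mul_pow, div_pow, sq_abs, mul_inv, inv_div, mul_comm]; ring]
        gcongr
        linarith
    _ = 4 * (Δ ^ 2)⁻¹ * ∑ k ∈ (Finset.univ.erase j).image fun l => round (y l),
          ((k : ℝ) ^ 2)⁻¹ := by
        rw [Finset.sum_image hinj, Finset.mul_sum]
    _ ≤ 4 * (Δ ^ 2)⁻¹ * 4 := by
        gcongr
        exact sum_inv_sq_int_le _
    _ = 16 * (Δ ^ 2)⁻¹ := by ring

theorem wrapDist_le {r : ℕ} (τ : Fin r → ℝ) {l l' : Fin r} (h : l ≠ l') (p : ℤ) :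
    wrapDist τ ≤ ENNReal.ofReal |τ l - τ l' + p| :=
  iInf_le_of_le l <| iInf_le_of_le l' <| iInf_le_of_le h <| iInf_le _ p

theorem ampMin_le {r : ℕ} (a : Fin r → ℂ) (j : Fin r) : ampMin a ≤ ‖a j‖ :=
  ciInf_le (Set.finite_range _).bddBelow j

theorem ampMin_pos {r : ℕ} [Nonempty (Fin r)] {a : Fin r → ℂ} (ha : ∀ j, a j ≠ 0) :
    0 < ampMin a := by
  obtain ⟨j, hj⟩ := exists_eq_ciInf_of_finite (f := fun j => ‖a j‖)
  rw [ampMin, ← hj]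
  exact norm_pos_iff.2 (ha j)

theorem ampMin_le_norm {r : ℕ} [Nonempty (Fin r)] (a : Fin r → ℂ) : ampMin a ≤ ‖a‖ :=
  (ampMin_le a (Classical.arbitrary _)).trans (norm_le_pi_norm a _)

/-- The interference of separated spikes, measured by the inverse square law, is controlled
by `η`. -/
theorem separation_of_eta_lt_one {n r : ℕ} [Nonempty (Fin r)] {A : ℝ} {θstar : Params r}
    (ha : ∀ j, θstar.1 j ≠ 0) (hA : 3 / 2 * ‖θstar.1‖ ≤ A) (hη : eta n A θstar < 1) (j : Fin r) :
    (∀ l ≠ j, 24.9 ≤ ((n : ℝ) + 1) * intDist (θstar.2 j - θstar.2 l)) ∧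
    276.21 * (A ^ 2 * ‖θstar.1‖ / ampMin θstar.1 ^ 3) *
      ∑ l ∈ Finset.univ.erase j, ((((n : ℝ) + 1) * intDist (θstar.2 j - θstar.2 l)) ^ 2)⁻¹ ≤
        16 * (eta n A θstar).toReal := by
  by_cases hex : ∃ l, l ≠ j
  swap
  · push Not at hex
    have : Finset.univ.erase j = (∅ : Finset (Fin r)) := by
      ext l; simp [hex l]
    refine ⟨fun l hl => absurd (hex l) hl, ?_⟩
    rw [this, Finset.sum_empty, mul_zero]
    positivity
  obtain ⟨l₀, hl₀⟩ := hex
  have hmin := ampMin_pos ha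
  have hle := ampMin_le_norm θstar.1
  have hnorm : 0 < ‖θstar.1‖ := hmin.trans_le hle
  set c := 276.21 * (A ^ 2 * ‖θstar.1‖ / ampMin θstar.1 ^ 3) with hc
  have hc1 : 621 ≤ c := by
    have h1 : 9 / 4 ≤ A ^ 2 * ‖θstar.1‖ / ampMin θstar.1 ^ 3 := by
      rw [le_div_iff₀ (by positivity)]
      have h2 : (3 / 2 * ‖θstar.1‖) ^ 2 ≤ A ^ 2 := pow_le_pow_left₀ (by positivity) hA 2
      have h3 : ampMin θstar.1 ^ 3 ≤ ‖θstar.1‖ ^ 3 := pow_le_pow_left₀ hmin.le hle 3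
      have h4 := mul_le_mul_of_nonneg_right h2 hnorm.le
      linarith
    rw [hc]
    linarith
  have htop : wrapDist θstar.2 ≠ ⊤ :=
    ((wrapDist_le θstar.2 hl₀ 0).trans_lt ENNReal.ofReal_lt_top).ne
  -- Coinciding locations would give η = ∞, because the leading factor is not zero and 0⁻¹ = ∞ in
  -- `ENNReal`.
  have hzero : wrapDist θstar.2 ≠ 0 := by
    intro h0
    have : ENNReal.ofReal c ≠ 0 := by
      rw [Ne, ENNReal.ofReal_eq_zero]; linarith
    rw [eta, h0, mul_zero, zero_pow two_ne_zero, ENNReal.inv_zero, ENNReal.mul_top this] at hη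
    exact absurd hη (by simp)
  set Δ := (wrapDist θstar.2).toReal with hΔ
  have hΔ0 : 0 < Δ := ENNReal.toReal_pos hzero htop
  have hsep : ∀ l l', l ≠ l' → ∀ p : ℤ, Δ ≤ |θstar.2 l - θstar.2 l' + p| := fun l l' h p =>
    ENNReal.toReal_le_of_le_ofReal (abs_nonneg _) (wrapDist_le θstar.2 h p)
  have heta : (eta n A θstar).toReal = c * (((((n : ℝ) + 1) * Δ) ^ 2)⁻¹) := by
    rw [eta, ENNReal.toReal_mul, ENNReal.toReal_ofReal (by linarith), ENNReal.toReal_inv,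
      ENNReal.toReal_pow, ENNReal.toReal_mul, ENNReal.toReal_add (by simp) (by simp),
      ENNReal.toReal_natCast, ENNReal.toReal_one]
  have hlt : (eta n A θstar).toReal < 1 := by
    simpa using (ENNReal.toReal_lt_toReal hη.ne_top ENNReal.one_ne_top).2 hη
  have hn : 0 < (n : ℝ) + 1 := by positivity
  -- η < 1 gives ((n+1)Δ)² > c ≥ 621 > 24.9², where 621 < 276.21 · 9/4.
  have hmΔ : 24.9 ≤ ((n : ℝ) + 1) * Δ := by
    rw [heta, ← div_eq_mul_inv, div_lt_one (by positivity)] at hlt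
    refine (abs_le_of_sq_le_sq' ?_ (by positivity)).2
    norm_num
    linarith
  refine ⟨fun l hl => hmΔ.trans ?_, ?_⟩
  · gcongr
    rw [intDist, sub_eq_add_neg _ (round _ : ℝ)]
    simpa using hsep j l hl.symm (-round (θstar.2 j - θstar.2 l))
  · have h1 := sum_inv_intDist_sq_le hΔ0 hsep j
    rw [heta]
    simp only [mul_pow, mul_inv, ← Finset.mul_sum]
    have h2 := mul_le_mul_of_nonneg_left h1
      (mul_nonneg (by linarith : 0 ≤ c) (by positivity : 0 ≤ (((n : ℝ) + 1) ^ 2)⁻¹))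
    linarith

/-! ### One step of the iteration. -/

/-- The difference splits as (a - b) f(u) + b (f(u) - f(v)), with the mean value inequality for the
second part. Bounds on a ball suffice because it is convex, and the kernel bounds hold only away
from the integers. -/
theorem norm_mul_sub_mul_le {f f' : ℝ → ℝ} (hf : ∀ t, HasDerivAt f (f' t) t) {c R B B' : ℝ}
    (hB : ∀ t ∈ Metric.closedBall c R, |f t| ≤ B)
    (hB' : ∀ t ∈ Metric.closedBall c R, |f' t| ≤ B') {u v : ℝ}
    (hu : u ∈ Metric.closedBall c R) (hv : v ∈ Metric.closedBall c R) (a b : ℂ) :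
    ‖a * (f u : ℂ) - b * (f v : ℂ)‖ ≤ ‖a - b‖ * B + ‖b‖ * (B' * |u - v|) := by
  have h1 : |f u - f v| ≤ B' * |u - v| :=
    (convex_closedBall c R).norm_image_sub_le_of_norm_hasDerivWithin_le
      (fun t _ => (hf t).hasDerivWithinAt) hB' hv hu
  calc ‖a * (f u : ℂ) - b * (f v : ℂ)‖
      = ‖(a - b) * (f u : ℂ) + b * ((f u - f v : ℝ) : ℂ)‖ := by
        congr 1; push_cast; ring
    _ ≤ ‖a - b‖ * |f u| + ‖b‖ * |f u - f v| := by
        refine (norm_add_le _ _).trans ?_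
        rw [norm_mul, norm_mul, Complex.norm_real, Complex.norm_real, Real.norm_eq_abs,
          Real.norm_eq_abs]
    _ ≤ _ := by gcongr; exact hB u hu

/-- The contribution of another spike to the gradient, linearized around the true spikes. -/
theorem cross_term_le {n : ℕ} (hn : 2 ≤ n) {t₀ : ℝ} (ht₀ : 24.9 ≤ ((n : ℝ) + 1) * intDist t₀)
    {u v e : ℝ} (hu : ((n : ℝ) + 1) * |u - t₀| ≤ 1 / 2) (hv : ((n : ℝ) + 1) * |v - t₀| ≤ 1 / 2)
    (huv : Real.sqrt (-fejerCurv n) * |u - v| ≤ e) {a b : ℂ} (hab : ‖a - b‖ ≤ e * ‖b‖) :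
    ‖a * (fejer n u : ℂ) - b * (fejer n v : ℂ)‖ ≤
        ‖b‖ * e * (1.05 * ((((n : ℝ) + 1) * intDist t₀) ^ 2)⁻¹) ∧
      ‖a * (fejerDeriv n u : ℂ) - b * (fejerDeriv n v : ℂ)‖ ≤
        2 * (‖b‖ * e * (1.05 * ((((n : ℝ) + 1) * intDist t₀) ^ 2)⁻¹)) *
          Real.sqrt (-fejerCurv n) := by
  set m : ℝ := (n : ℝ) + 1
  have hm : 0 < m := by positivity
  set d := intDist t₀
  set R : ℝ := 1 / 2 / m
  have hmR : m * R = 1 / 2 := by simp only [R]; field_simp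
  have hC : 0 ≤ -fejerCurv n := le_trans (by positivity) (five_mul_sq_le_neg_fejerCurv hn)
  have hCs := Real.mul_self_sqrt hC
  set s := Real.sqrt (-fejerCurv n)
  have hs : 0 ≤ s := Real.sqrt_nonneg _
  have he : 0 ≤ e := le_trans (by positivity) huv
  have hmρ : m * (d - R) = m * d - 1 / 2 := by rw [mul_sub, hmR]
  set X := ((m * (d - R)) ^ 2)⁻¹
  have hX0 : 0 ≤ X := by positivity
  -- Moving by at most 1/2 in units of 1/(n+1) costs the factor (24.9/24.4)² < 1.05.
  have hX : X ≤ 1.05 * ((m * d) ^ 2)⁻¹ := by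
    simp only [X, hmρ]
    have h1 : 0 < m * d - 1 / 2 := by linarith
    have h2 : 0 < m * d := by linarith
    rw [← div_eq_mul_inv, inv_eq_one_div, div_le_div_iff₀ (by positivity) (by positivity)]
    nlinarith
  have far (t : ℝ) (ht : t ∈ Metric.closedBall t₀ R) : |fejer n t| ≤ 1 / 2 * X ∧
      |fejerDeriv n t| ≤ 1 / 2 * X * s ∧ |fejerDerivTwo n t| ≤ 3 / 2 * X * -fejerCurv n := by
    refine fejer_far_field hn (by rw [hmρ]; linarith) fun p => ?_
    rw [Metric.mem_closedBall, Real.dist_eq] at ht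
    have h1 : intDist t₀ ≤ |t₀ + p| := intDist_le t₀ p
    have h2 := abs_sub_abs_le_abs_sub (t₀ + p) (t + p)
    rw [add_sub_add_right_eq_sub, abs_sub_comm t₀] at h2
    linarith
  have hu' : u ∈ Metric.closedBall t₀ R := by
    rw [Metric.mem_closedBall, Real.dist_eq, le_div_iff₀' hm]; exact hu
  have hv' : v ∈ Metric.closedBall t₀ R := by
    rw [Metric.mem_closedBall, Real.dist_eq, le_div_iff₀' hm]; exact hv
  have hb := norm_nonneg b
  constructor
  · refine (norm_mul_sub_mul_le (hasDerivAt_fejer n) (fun t ht => (far t ht).1)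
      (fun t ht => (far t ht).2.1) hu' hv' a b).trans ?_
    calc ‖a - b‖ * (1 / 2 * X) + ‖b‖ * (1 / 2 * X * s * |u - v|)
        = ‖a - b‖ * (1 / 2 * X) + ‖b‖ * (1 / 2 * X * (s * |u - v|)) := by ring
      _ ≤ e * ‖b‖ * (1 / 2 * X) + ‖b‖ * (1 / 2 * X * e) := by gcongr
      _ = ‖b‖ * e * X := by ring
      _ ≤ _ := by gcongr
  · refine (norm_mul_sub_mul_le (hasDerivAt_fejerDeriv n) (fun t ht => (far t ht).2.1)
      (fun t ht => (far t ht).2.2) hu' hv' a b).trans ?_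
    calc ‖a - b‖ * (1 / 2 * X * s) + ‖b‖ * (3 / 2 * X * -fejerCurv n * |u - v|)
        = ‖a - b‖ * (1 / 2 * X * s) + ‖b‖ * (3 / 2 * X * s * (s * |u - v|)) := by
          rw [← hCs]; ring
      _ ≤ e * ‖b‖ * (1 / 2 * X * s) + ‖b‖ * (3 / 2 * X * s * e) := by gcongr
      _ = 2 * (‖b‖ * e * X) * s := by ring
      _ ≤ _ := by gcongr

/-- The Newton-like step for the location of a single spike. -/
theorem abs_add_mul_fejerDeriv_le {n : ℕ} (hn : 2 ≤ n) {δ R b : ℝ}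
    (hδ : ((n : ℝ) + 1) * |δ| ≤ 1 / 4) (hb : 0 ≤ b) (hR : b / 2 ≤ R) (hR' : R ≤ 2 / 3) :
    |δ + R * (fejerDeriv n δ / -fejerCurv n)| ≤ (1 - b / 4) * |δ| := by
  rcases eq_or_ne δ 0 with rfl | h0
  · simp [fejerDeriv_zero]
  have hC : 0 < -fejerCurv n := lt_of_lt_of_le (by positivity) (five_mul_sq_le_neg_fejerCurv hn)
  have h1 := neg_mul_fejerDeriv_le n δ
  have h2 := le_neg_mul_fejerDeriv hδ
  have hpi : 1 / 2 ≤ 2 / Real.pi := by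
    rw [div_le_div_iff₀ two_pos Real.pi_pos]; linarith [Real.pi_le_four]
  set C := -fejerCurv n
  -- Multiplied by |δ|, the new error is |δ² - Rp|, with p between δ²/2 and δ².
  obtain ⟨p, hp⟩ : ∃ p, p = -(δ * fejerDeriv n δ) / C := ⟨_, rfl⟩
  have hp1 : p ≤ δ ^ 2 := by rw [hp, div_le_iff₀ hC]; linarith
  have hp2 : 1 / 2 * δ ^ 2 ≤ p := by
    rw [hp, le_div_iff₀ hC]
    have := mul_le_mul_of_nonneg_right hpi (by positivity : 0 ≤ C * δ ^ 2)
    linarith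
  have e1 : |δ| * |δ + R * (fejerDeriv n δ / C)| = |δ ^ 2 - R * p| := by
    rw [← abs_mul, hp]
    congr 1
    ring
  refine le_of_mul_le_mul_left ?_ (abs_pos.2 h0)
  rw [e1, show |δ| * ((1 - b / 4) * |δ|) = (1 - b / 4) * δ ^ 2 by rw [← sq_abs δ]; ring, abs_le]
  have hR0 : 0 ≤ R := by linarith
  have h3 := mul_le_mul_of_nonneg_left hp1 hR0
  have h4 := mul_le_mul_of_nonneg_left hp2 hR0
  have h5 := mul_le_mul_of_nonneg_right hR (sq_nonneg δ)
  have h6 := mul_le_mul_of_nonneg_right hR' (sq_nonneg δ)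
  constructor <;> nlinarith only [h3, h4, h5, h6, hb, sq_nonneg δ]

/-- A relative error of at most 1/2 keeps `a` in the half-plane around `b`, so the location gradient
of the spike itself keeps its sign. -/
theorem re_conj_mul_bounds {a b : ℂ} {e : ℝ} (he : e ≤ 1 / 2) (h : ‖a - b‖ ≤ e * ‖b‖) :
    ‖b‖ ^ 2 / 2 ≤ (conj a * b).re ∧ (conj a * b).re ≤ 3 / 2 * ‖b‖ ^ 2 := by
  have h1 : (conj a * b).re = ‖b‖ ^ 2 + (conj (a - b) * b).re := by
    rw [map_sub, sub_mul, Complex.sub_re, ← Complex.normSq_eq_conj_mul_self, Complex.ofReal_re,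
      Complex.normSq_eq_norm_sq]
    ring
  have h2 : |(conj (a - b) * b).re| ≤ ‖b‖ ^ 2 / 2 := by
    refine (Complex.abs_re_le_norm _).trans ?_
    rw [norm_mul, Complex.norm_conj]
    nlinarith [norm_nonneg b, mul_le_mul_of_nonneg_right h (norm_nonneg b),
      mul_le_mul_of_nonneg_right he (sq_nonneg ‖b‖)]
  have h3 := abs_le.1 h2
  constructor <;> linarith [h3.1, h3.2]

theorem norm_fst_le_of_weight {n r : ℕ} {θstar v : Params r} (ha : ∀ j, θstar.1 j ≠ 0)
    (j : Fin r) : ‖v.1 j‖ ≤ ‖weight n θstar v‖ * ‖θstar.1 j‖ := by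
  have h : ‖(θstar.1 j)⁻¹ * v.1 j‖ ≤ ‖weight n θstar v‖ :=
    (norm_le_pi_norm (weight n θstar v).1 j).trans (norm_fst_le _)
  rwa [norm_mul, norm_inv, inv_mul_le_iff₀ (norm_pos_iff.2 (ha j)), mul_comm] at h

theorem abs_snd_le_of_weight {n r : ℕ} {θstar v : Params r} (j : Fin r) :
    Real.sqrt (-fejerCurv n) * |v.2 j| ≤ ‖weight n θstar v‖ := by
  have h : ‖Real.sqrt (-fejerCurv n) * v.2 j‖ ≤ ‖weight n θstar v‖ :=
    (norm_le_pi_norm (weight n θstar v).2 j).trans (norm_snd_le _)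
  rwa [norm_mul, Real.norm_of_nonneg (Real.sqrt_nonneg _)] at h

theorem weight_norm_le {n r : ℕ} {θstar v : Params r} (ha : ∀ j, θstar.1 j ≠ 0) {B : ℝ}
    (hB : 0 ≤ B) (h1 : ∀ j, ‖v.1 j‖ ≤ B * ‖θstar.1 j‖)
    (h2 : ∀ j, Real.sqrt (-fejerCurv n) * |v.2 j| ≤ B) : ‖weight n θstar v‖ ≤ B := by
  rw [Prod.norm_def, max_le_iff, pi_norm_le_iff_of_nonneg hB, pi_norm_le_iff_of_nonneg hB]
  refine ⟨fun j => ?_, fun j => ?_⟩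
  · change ‖(θstar.1 j)⁻¹ * v.1 j‖ ≤ B
    rw [norm_mul, norm_inv, inv_mul_le_iff₀ (norm_pos_iff.2 (ha j)), mul_comm]
    exact h1 j
  · change ‖Real.sqrt (-fejerCurv n) * v.2 j‖ ≤ B
    rw [norm_mul, Real.norm_of_nonneg (Real.sqrt_nonneg _)]
    exact h2 j

/-- The interference at the `j`-th spike is at most a fraction of `η`. -/
theorem interference_le {n r : ℕ} [Nonempty (Fin r)] {A : ℝ} {θstar : Params r}
    (ha : ∀ j, θstar.1 j ≠ 0) (hA : 3 / 2 * ‖θstar.1‖ ≤ A) (hη : eta n A θstar < 1) (j : Fin r) :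
    ‖θstar.1‖ * ∑ l ∈ Finset.univ.erase j,
        (1.05 * ((((n : ℝ) + 1) * intDist (θstar.2 j - θstar.2 l)) ^ 2)⁻¹) ≤
      1 / 16 * (eta n A θstar).toReal * (ampMin θstar.1 ^ 2 / A ^ 2) * ampMin θstar.1 := by
  have h := (separation_of_eta_lt_one ha hA hη j).2
  have hmin := ampMin_pos ha
  have hnorm : 0 < ‖θstar.1‖ := hmin.trans_le (ampMin_le_norm θstar.1)
  have hA0 : 0 < A := by linarith
  have hη0 : 0 ≤ (eta n A θstar).toReal := ENNReal.toReal_nonneg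
  rw [← Finset.mul_sum]
  set X := ∑ l ∈ Finset.univ.erase j,
    ((((n : ℝ) + 1) * intDist (θstar.2 j - θstar.2 l)) ^ 2)⁻¹
  have e1 : 276.21 * (A ^ 2 * ‖θstar.1‖ / ampMin θstar.1 ^ 3) * X =
      276.21 * (‖θstar.1‖ * X) * (A ^ 2 / ampMin θstar.1 ^ 3) := by ring
  have e2 : 1 / 16 * (eta n A θstar).toReal * (ampMin θstar.1 ^ 2 / A ^ 2) * ampMin θstar.1 =
      1 / 16 * (eta n A θstar).toReal / (A ^ 2 / ampMin θstar.1 ^ 3) := by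
    field_simp
  rw [e2, le_div_iff₀ (by positivity)]
  rw [e1] at h
  -- The constant 276.21 enters through 1.05 · 16 / 276.21 < 1/16.
  linarith

/-- One step of preconditioned gradient descent contracts the weighted error. -/
theorem weight_step_le {n r : ℕ} [Nonempty (Fin r)] (hn : 2 ≤ n) {A : ℝ} {θstar : Params r}
    (ha : ∀ j, θstar.1 j ≠ 0) (hA : 3 / 2 * ‖θstar.1‖ ≤ A) (hη : eta n A θstar < 1)
    {θ : Params r} (hθ : ‖weight n θstar (θ - θstar)‖ ≤ 1 / 2) :
    ‖weight n θstar (θ - precond n A (gradLoss n θstar θ) - θstar)‖ ≤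
      (1 - 1 / 4 * (ampMin θstar.1 ^ 2 / A ^ 2) * (1 - (eta n A θstar).toReal)) *
        ‖weight n θstar (θ - θstar)‖ := by
  have hmin := ampMin_pos ha
  have hle := ampMin_le_norm θstar.1
  have hN : 0 < ‖θstar.1‖ := hmin.trans_le hle
  have hA0 : 0 < A := by linarith
  have hη0 : 0 ≤ (eta n A θstar).toReal := ENNReal.toReal_nonneg
  have hNA : ‖θstar.1‖ ^ 2 ≤ 4 / 9 * A ^ 2 := by
    have := pow_le_pow_left₀ (by positivity) hA 2
    linarith
  have hb : ampMin θstar.1 ^ 2 / A ^ 2 ≤ 4 / 9 := by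
    rw [div_le_iff₀ (by positivity)]
    exact (pow_le_pow_left₀ hmin.le hle 2).trans hNA
  have hb0 : 0 ≤ ampMin θstar.1 ^ 2 / A ^ 2 := by positivity
  have hinter := interference_le ha hA hη
  have hbA : ampMin θstar.1 ^ 2 / A ^ 2 * A ^ 2 = ampMin θstar.1 ^ 2 :=
    div_mul_cancel₀ _ (by positivity)
  set η := (eta n A θstar).toReal
  set b := ampMin θstar.1 ^ 2 / A ^ 2
  set e := ‖weight n θstar (θ - θstar)‖
  have he : 0 ≤ e := norm_nonneg _
  have hamp (l : Fin r) : ‖θ.1 l - θstar.1 l‖ ≤ e * ‖θstar.1 l‖ :=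
    norm_fst_le_of_weight (v := θ - θstar) ha l
  have hloc (l : Fin r) : Real.sqrt (-fejerCurv n) * |θ.2 l - θstar.2 l| ≤ e :=
    abs_snd_le_of_weight (v := θ - θstar) l
  have hC5 := five_mul_sq_le_neg_fejerCurv hn
  have hm : 0 < (n : ℝ) + 1 := by positivity
  have hC : 0 < -fejerCurv n := lt_of_lt_of_le (by positivity) hC5
  have hCs := Real.mul_self_sqrt hC.le
  have hs2 : 2 * ((n : ℝ) + 1) ≤ Real.sqrt (-fejerCurv n) :=
    Real.le_sqrt_of_sq_le (by nlinarith only [sq_nonneg ((n : ℝ) + 1), hC5])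
  have hs : 0 < Real.sqrt (-fejerCurv n) := by linarith
  -- Since √(-F_N''(0)) ≥ 2(n+1), the radius e ≤ 1/2 becomes 1/4 in units of 1/(n+1).
  have hquarter (l : Fin r) : ((n : ℝ) + 1) * |θ.2 l - θstar.2 l| ≤ 1 / 4 := by
    have := mul_le_mul_of_nonneg_right hs2 (abs_nonneg (θ.2 l - θstar.2 l))
    linarith [hloc l]
  have hcross (j l : Fin r) (hl : l ∈ Finset.univ.erase j) :=
    cross_term_le hn ((separation_of_eta_lt_one ha hA hη j).1 l (Finset.ne_of_mem_erase hl))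
      (u := θ.2 j - θ.2 l) (v := θ.2 j - θstar.2 l) (e := e)
      (by
        have := abs_sub (θ.2 j - θstar.2 j) (θ.2 l - θstar.2 l)
        rw [show θ.2 j - θ.2 l - (θstar.2 j - θstar.2 l) =
          θ.2 j - θstar.2 j - (θ.2 l - θstar.2 l) by ring]
        nlinarith only [this, hquarter j, hquarter l, hm])
      (by
        rw [sub_sub_sub_cancel_right]
        linarith [hquarter j])
      (by
        rw [sub_sub_sub_cancel_left, abs_sub_comm]
        exact hloc l)
      (hamp l)
  have hsum (j : Fin r) :
      ∑ l ∈ Finset.univ.erase j, ‖θstar.1 l‖ * e *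
        (1.05 * ((((n : ℝ) + 1) * intDist (θstar.2 j - θstar.2 l)) ^ 2)⁻¹) ≤
      e * (1 / 16 * η * b * ampMin θstar.1) := by
    refine le_trans ?_ (mul_le_mul_of_nonneg_left (hinter j) he)
    rw [Finset.mul_sum, Finset.mul_sum]
    refine Finset.sum_le_sum fun l _ => ?_
    rw [mul_comm ‖θstar.1 l‖, mul_assoc e]
    have := norm_le_pi_norm θstar.1 l
    gcongr
  refine weight_norm_le ha (mul_nonneg (by nlinarith) he) (fun j => ?_) (fun j => ?_)
  · have hj : (θ - precond n A (gradLoss n θstar θ) - θstar).1 j =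
        θstar.1 j * ((fejer n (θ.2 j - θstar.2 j) - 1 : ℝ) : ℂ) -
          ∑ l ∈ Finset.univ.erase j, (θ.1 l * (fejer n (θ.2 j - θ.2 l) : ℂ) -
            θstar.1 l * (fejer n (θ.2 j - θstar.2 l) : ℂ)) := by
      change θ.1 j - (gradLoss n θstar θ).1 j - θstar.1 j = _
      rw [gradLoss_fst, ← Finset.add_sum_erase _ _ (Finset.mem_univ j), sub_self, fejer_zero]
      push_cast
      ring
    have hF : |fejer n (θ.2 j - θstar.2 j) - 1| ≤ e / 4 := by
      refine (abs_fejer_sub_one_le n _).trans ?_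
      have h1 : -fejerCurv n * (θ.2 j - θstar.2 j) ^ 2 ≤ e ^ 2 := by
        rw [← hCs, ← sq, ← sq_abs (θ.2 j - θstar.2 j), ← mul_pow]
        exact pow_le_pow_left₀ (by positivity) (hloc j) 2
      nlinarith only [h1, hθ, he]
    have hcr : ‖∑ l ∈ Finset.univ.erase j, (θ.1 l * (fejer n (θ.2 j - θ.2 l) : ℂ) -
        θstar.1 l * (fejer n (θ.2 j - θstar.2 l) : ℂ))‖ ≤ e * (1 / 16 * η * b * ‖θstar.1 j‖) := by
      refine (norm_sum_le_of_le _ fun l hl => (hcross j l hl).1).trans ((hsum j).trans ?_)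
      gcongr
      exact ampMin_le _ j
    rw [hj]
    refine (norm_sub_le _ _).trans ?_
    rw [norm_mul, Complex.norm_real, Real.norm_eq_abs]
    have h1 := mul_le_mul_of_nonneg_left hF (norm_nonneg (θstar.1 j))
    -- The amplitude bound has room to spare: b ≤ 4/9 makes the right side at least 8/9. The rate is
    -- set by the locations.
    have h2 : 1 / 4 + 1 / 16 * η * b ≤ 1 - 1 / 4 * b * (1 - η) := by
      nlinarith only [mul_nonneg hη0 hb0, hb]
    have h3 := mul_le_mul_of_nonneg_right h2 (mul_nonneg he (norm_nonneg (θstar.1 j)))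
    linarith
  · set δ := θ.2 j - θstar.2 j
    set cr := ∑ l ∈ Finset.univ.erase j, (θ.1 l * (fejerDeriv n (θ.2 j - θ.2 l) : ℂ) -
            θstar.1 l * (fejerDeriv n (θ.2 j - θstar.2 l) : ℂ)) with hcr'
    set R := (conj (θ.1 j) * θstar.1 j).re / A ^ 2 with hR
    have hj : (θ - precond n A (gradLoss n θstar θ) - θstar).2 j =
        δ + R * (fejerDeriv n δ / -fejerCurv n) -
          (-fejerCurv n)⁻¹ * (A ^ 2)⁻¹ * (conj (θ.1 j) * cr).re := by
      change θ.2 j - (-(fejerCurv n)⁻¹ * (A ^ 2)⁻¹) * (gradLoss n θstar θ).2 j - θstar.2 j = _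
      rw [gradLoss_snd, ← Finset.add_sum_erase _ _ (Finset.mem_univ j), sub_self, fejerDeriv_zero,
        Complex.ofReal_zero, mul_zero, zero_sub, ← hcr', mul_add, Complex.add_re, mul_neg,
        Complex.neg_re, ← mul_assoc, Complex.re_mul_ofReal, hR, inv_neg, div_neg]
      simp only [δ]
      ring
    -- Divided by A², these bounds place R between b/2 and 3/2 · 4/9 = 2/3; the latter uses A ≥
    -- (3/2)‖a⋆‖∞.
    obtain ⟨hre1, hre2⟩ := re_conj_mul_bounds hθ (hamp j)
    have hjN : ‖θstar.1 j‖ ≤ ‖θstar.1‖ := norm_le_pi_norm θstar.1 j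
    have hmain : Real.sqrt (-fejerCurv n) * |δ + R * (fejerDeriv n δ / -fejerCurv n)| ≤
        (1 - b / 4) * e := by
      have h1 := abs_add_mul_fejerDeriv_le hn (hquarter j) hb0 (R := R)
        (by
          rw [hR, le_div_iff₀ (by positivity)]
          have := pow_le_pow_left₀ hmin.le (ampMin_le θstar.1 j) 2
          linarith)
        (by
          rw [hR, div_le_iff₀ (by positivity)]
          have := pow_le_pow_left₀ (norm_nonneg _) hjN 2
          linarith)
      have h2 := mul_le_mul_of_nonneg_left h1 hs.le
      have h3 := mul_le_mul_of_nonneg_left (hloc j) (by linarith : 0 ≤ 1 - b / 4)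
      linarith
    have hcr : ‖cr‖ ≤ 2 * (e * (1 / 16 * η * b * ‖θstar.1‖)) * Real.sqrt (-fejerCurv n) := by
      refine (norm_sum_le_of_le _ fun l hl => (hcross j l hl).2).trans ?_
      rw [← Finset.sum_mul, ← Finset.mul_sum]
      gcongr
      refine (hsum j).trans ?_
      gcongr
    have haj : ‖θ.1 j‖ ≤ 3 / 2 * ‖θstar.1‖ := by
      have h1 := norm_sub_norm_le (θ.1 j) (θstar.1 j)
      have h2 := mul_le_mul_of_nonneg_right hθ (norm_nonneg (θstar.1 j))
      linarith [hamp j]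
    have hrest : Real.sqrt (-fejerCurv n) *
        |(-fejerCurv n)⁻¹ * (A ^ 2)⁻¹ * (conj (θ.1 j) * cr).re| ≤ 1 / 4 * b * η * e := by
      have h1 : |(conj (θ.1 j) * cr).re| ≤ 3 / 2 * ‖θstar.1‖ *
          (2 * (e * (1 / 16 * η * b * ‖θstar.1‖)) * Real.sqrt (-fejerCurv n)) := by
        refine (Complex.abs_re_le_norm _).trans ?_
        rw [norm_mul, Complex.norm_conj]
        gcongr
      rw [abs_mul, abs_of_pos (by positivity : 0 < (-fejerCurv n)⁻¹ * (A ^ 2)⁻¹)]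
      calc _ ≤ Real.sqrt (-fejerCurv n) * ((-fejerCurv n)⁻¹ * (A ^ 2)⁻¹ * (3 / 2 * ‖θstar.1‖ *
          (2 * (e * (1 / 16 * η * b * ‖θstar.1‖)) * Real.sqrt (-fejerCurv n)))) := by gcongr
        _ = (Real.sqrt (-fejerCurv n) * Real.sqrt (-fejerCurv n)) * (-fejerCurv n)⁻¹ *
            (3 / 16 * (e * η * b) * (‖θstar.1‖ ^ 2 * (A ^ 2)⁻¹)) := by ring
        _ = 3 / 16 * (e * η * b) * (‖θstar.1‖ ^ 2 * (A ^ 2)⁻¹) := by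
            rw [hCs, mul_inv_cancel₀ hC.ne', one_mul]
        _ ≤ 3 / 16 * (e * η * b) * (4 / 9) := by
            gcongr
            rwa [← div_eq_mul_inv, div_le_iff₀ (by positivity)]
        _ ≤ 1 / 4 * b * η * e := by nlinarith only [mul_nonneg (mul_nonneg he hη0) hb0]
    rw [hj]
    have h1 := mul_le_mul_of_nonneg_left (abs_sub (δ + R * (fejerDeriv n δ / -fejerCurv n))
      ((-fejerCurv n)⁻¹ * (A ^ 2)⁻¹ * (conj (θ.1 j) * cr).re)) hs.le
    linarith

/-! ### From one step to convergence. -/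

theorem tendsto_of_weight_tendsto {n r : ℕ} (hn : 2 ≤ n) {θstar : Params r}
    (ha : ∀ j, θstar.1 j ≠ 0) {θ : ℕ → Params r}
    (h : Filter.Tendsto (fun k => ‖weight n θstar (θ k - θstar)‖) Filter.atTop (nhds 0)) :
    Filter.Tendsto θ Filter.atTop (nhds θstar) := by
  have hs : 0 < Real.sqrt (-fejerCurv n) :=
    Real.sqrt_pos.2 (lt_of_lt_of_le (by positivity) (five_mul_sq_le_neg_fejerCurv hn))
  refine Prod.tendsto_iff _ _ |>.2 ⟨tendsto_pi_nhds.2 fun j => ?_, tendsto_pi_nhds.2 fun j => ?_⟩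
  · rw [tendsto_iff_norm_sub_tendsto_zero]
    refine squeeze_zero (fun _ => norm_nonneg _)
      (fun k => norm_fst_le_of_weight (n := n) (v := θ k - θstar) ha j) ?_
    simpa using h.mul_const ‖θstar.1 j‖
  · rw [tendsto_iff_norm_sub_tendsto_zero]
    refine squeeze_zero (fun _ => norm_nonneg _)
      (fun k => (le_div_iff₀' hs).2 (abs_snd_le_of_weight (θstar := θstar)
        (v := θ k - θstar) j)) ?_
    simpa using h.div_const (Real.sqrt (-fejerCurv n))


end

end SpikeDeconv

theorem theorem1 (n r : ℕ) (hn : 2 ≤ n) (hr : 1 ≤ r) (A : ℝ)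
    (θstar : SpikeDeconv.Params r) (ha : ∀ j, θstar.1 j ≠ 0)
    (hA : 3 / 2 * ‖θstar.1‖ ≤ A)
    (hη : SpikeDeconv.eta n A θstar < 1)
    (θ : ℕ → SpikeDeconv.Params r)
    (hθ : SpikeDeconv.IsPrecondGD n A θstar θ)
    (h0 : ‖SpikeDeconv.weight n θstar (θ 0 - θstar)‖ ≤ 1 / 2) :
    (∀ k : ℕ, ‖SpikeDeconv.weight n θstar (θ k - θstar)‖ ≤
        (1 - 1 / 4 * (SpikeDeconv.ampMin θstar.1 ^ 2 / A ^ 2) *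
          (1 - (SpikeDeconv.eta n A θstar).toReal)) ^ k *
        ‖SpikeDeconv.weight n θstar (θ 0 - θstar)‖) ∧
      Filter.Tendsto θ Filter.atTop (nhds θstar) := by
  have : Nonempty (Fin r) := ⟨⟨0, hr⟩⟩
  have hmin := SpikeDeconv.ampMin_pos ha
  have hle := SpikeDeconv.ampMin_le_norm θstar.1
  have hA0 : 0 < A := by linarith
  have hη0 : 0 ≤ (SpikeDeconv.eta n A θstar).toReal := ENNReal.toReal_nonneg
  have hη1 : (SpikeDeconv.eta n A θstar).toReal < 1 := by
    simpa using (ENNReal.toReal_lt_toReal hη.ne_top ENNReal.one_ne_top).2 hη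
  have hb0 : 0 < SpikeDeconv.ampMin θstar.1 ^ 2 / A ^ 2 := by positivity
  have hb1 : SpikeDeconv.ampMin θstar.1 ^ 2 / A ^ 2 ≤ 1 := by
    rw [div_le_one (by positivity)]
    exact pow_le_pow_left₀ hmin.le (by linarith) 2
  obtain ⟨q, hq⟩ : ∃ q, q = 1 - 1 / 4 * (SpikeDeconv.ampMin θstar.1 ^ 2 / A ^ 2) *
    (1 - (SpikeDeconv.eta n A θstar).toReal) := ⟨_, rfl⟩
  have hq0 : 0 ≤ q := by nlinarith
  have hq1 : q < 1 := by nlinarith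
  rw [← hq]
  have hk (k : ℕ) : ‖SpikeDeconv.weight n θstar (θ k - θstar)‖ ≤
      q ^ k * ‖SpikeDeconv.weight n θstar (θ 0 - θstar)‖ := by
    induction k with
    | zero => simp
    | succ k ih =>
      -- Since q ≤ 1, the iterate has not left the ball of radius 1/2, so the one-step contraction
      -- applies again.
      have hhalf : ‖SpikeDeconv.weight n θstar (θ k - θstar)‖ ≤ 1 / 2 :=
        (ih.trans (mul_le_of_le_one_left (norm_nonneg _) (pow_le_one₀ hq0 hq1.le))).trans h0
      rw [hθ k, pow_succ', mul_assoc]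
      refine (SpikeDeconv.weight_step_le hn ha hA hη hhalf).trans ?_
      rw [← hq]
      exact mul_le_mul_of_nonneg_left ih hq0
  refine ⟨hk, SpikeDeconv.tendsto_of_weight_tendsto hn ha ?_⟩
  refine squeeze_zero (fun _ => norm_nonneg _) hk ?_
  simpa using (tendsto_pow_atTop_nhds_zero_of_lt_one hq0 hq1).mul_const
    ‖SpikeDeconv.weight n θstar (θ 0 - θstar)‖
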